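/- Let $p\ge 1$ be an integer, $q=e^{2\pi i/p}$, $R=\mathbb{C}[z,z^{-1}]$, and let $\sigma$ be the $\mathbb{C}$-algebra automorphism of $R$ with $\sigma(z)=q^{-1}z$. Let $\omega=\{(z-q^k)\mid 0\le k\le p-1\}$, the $\sigma$-orbit of the maximal ideal $(z-1)$, and let $\mathsf{M}_0=\{(z-1)^n\mid n\ge 0\}$. For $t\in\mathsf{M}_0$ let $A(t)$ be the generalized Weyl algebra obtained from $R$ by adjoining generators $X,Y$ with relations $Xr=\sigma(r)X$, $Yr=\sigma^{-1}(r)Y$ $(r\in R)$, $YX=t$, $XY=\sigma(t)$. Let $A(t)\text{-wmod}_\omega$ be the category of $A(t)$-modules $M$ such that $M=\bigoplus_{\mathfrak m\in\operatorname{MaxSpec}(R)}M_{\mathfrak m}$, where $M_{\mathfrak m}=\{v\in M\mid \mathfrak m v=0\}$, each $M_{\mathfrak m}$ is finite-dimensional over $R/\mathfrak m$, and $M_{\mathfrak m}=0$ for $\mathfrak m\notin\omega$. If $M\in A(t)\text{-wmod}_\omega$ and $N\in A(t')\text{-wmod}_\omega$, then $M\otimes_R N$ is an object of $A(tt')\text{-wmod}_\omega$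 with $X(v\otimes w)=Xv\otimes Xw$ and $Y(v\otimes w)=Yv\otimes Yw$. Let $$\mathscr{A}(\omega,\mathsf{M}_0)=\bigoplus_{t\in\mathsf{M}_0}\mathbb{C}\otimes_{\mathbb Z}K_0\big(A(t)\text{-wmod}_\omega\big),\qquad \mathscr{A}^{\mathrm{split}}(\omega,\mathsf{M}_0)=\bigoplus_{t\in\mathsf{M}_0}\mathbb{C}\otimes_{\mathbb Z}K_0^{\mathrm{split}}\big(A(t)\text{-wmod}_\omega\big),$$ where $K_0$ is the Grothendieck group (with relations $[M]=[M']+[M'']$ for all short exact sequences $0\to M'\to M\to M''\to 0$) and $K_0^{\mathrm{split}}$ is the split Grothendieck group (with relations $[M'\oplus M'']=[M']+[M'']$). Both are commutative $\mathbb{C}$-algebras with multiplication $[M][N]=[M\otimes_R N]$, and $[M]\mapsto[M]$ defines an algebra map $\pi:\mathscr{A}^{\mathrm{split}}(\omega,\mathsf{M}_0)\to\mathscr{A}(\omega,\mathsf{M}_0)$. Let $\mathscr{A}_{(1)}\subseteq\mathscr{A}^{\mathrm{split}}(\omega,\mathsf{M}_0)$ be the subspace spanned by the classes of indecomposable modules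 of length at most $1$ in the categories $A(t)\text{-wmod}_\omega$, $t\in\mathsf{M}_0$. Then the following hold. 1. If $t,t'\in\mathsf{M}_0$ and $M\in A(t)\text{-wmod}_\omega$, $N\in A(t')\text{-wmod}_\omega$ are simple modules over $A(t)$ and $A(t')$, then $M\otimes_R N$ is a simple $A(tt')$-module. 2. $\mathscr{A}_{(1)}$ is the span of the classes of simple modules, and it is a (unital) subalgebra of $\mathscr{A}^{\mathrm{split}}(\omega,\mathsf{M}_0)$. 3. $\pi$ is surjective, and there is a homomorphism of $\mathbb{C}$-algebras $s:\mathscr{A}(\omega,\mathsf{M}_0)\to\mathscr{A}^{\mathrm{split}}(\omega,\mathsf{M}_0)$ with $\pi\circ s=\mathrm{id}$ that gives an isomorphism of algebras $\mathscr{A}(\omega,\mathsf{M}_0)\cong\mathscr{A}_{(1)}$. -/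

import Mathlib

open scoped TensorProduct DirectSum

noncomputable section

namespace WeightRing

/-! ### Generalized Weyl algebras -/

/-- Generators of the generalized Weyl algebra `A(R, σ, t)`: the elements of `R`, and `X`, `Y`. -/
inductive GWAGen (R : Type) : Type
  | coe (r : R)
  | X
  | Y

/-- Defining relations of `A(R, σ, t)`. The first three say that `R → A(R, σ, t)` is a ring
homomorphism. -/
inductive GWARel {R : Type} [CommRing R] (σ : R ≃+* R) (t : R) :
    FreeAlgebra ℤ (GWAGen R) → FreeAlgebra ℤ (GWAGen R) → Prop
  | one : GWARel σ t (FreeAlgebra.ι ℤ (.coe 1)) 1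
  | add (r s : R) : GWARel σ t (FreeAlgebra.ι ℤ (.coe (r + s)))
      (FreeAlgebra.ι ℤ (.coe r) + FreeAlgebra.ι ℤ (.coe s))
  | mul (r s : R) : GWARel σ t (FreeAlgebra.ι ℤ (.coe (r * s)))
      (FreeAlgebra.ι ℤ (.coe r) * FreeAlgebra.ι ℤ (.coe s))
  | X_coe (r : R) : GWARel σ t (FreeAlgebra.ι ℤ .X * FreeAlgebra.ι ℤ (.coe r))
      (FreeAlgebra.ι ℤ (.coe (σ r)) * FreeAlgebra.ι ℤ .X)
  | Y_coe (r : R) : GWARel σ t (FreeAlgebra.ι ℤ .Y * FreeAlgebra.ι ℤ (.coe r))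
      (FreeAlgebra.ι ℤ (.coe (σ.symm r)) * FreeAlgebra.ι ℤ .Y)
  | Y_X : GWARel σ t (FreeAlgebra.ι ℤ .Y * FreeAlgebra.ι ℤ .X) (FreeAlgebra.ι ℤ (.coe t))
  | X_Y : GWARel σ t (FreeAlgebra.ι ℤ .X * FreeAlgebra.ι ℤ .Y) (FreeAlgebra.ι ℤ (.coe (σ t)))

/-- The generalized Weyl algebra `A(t) = A(R, σ, t)` of rank one. -/
def GWA {R : Type} [CommRing R] (σ : R ≃+* R) (t : R) : Type := RingQuot (GWARel σ t)

namespace GWA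

variable {R : Type} [CommRing R] (σ : R ≃+* R) (t : R)

instance : Ring (GWA σ t) := inferInstanceAs (Ring (RingQuot (GWARel σ t)))

/-- The quotient map from the free algebra. -/
def mk : FreeAlgebra ℤ (GWAGen R) →+* GWA σ t := RingQuot.mkRingHom (GWARel σ t)

theorem mk_surjective : Function.Surjective (mk σ t) := RingQuot.mkRingHom_surjective _

theorem mk_rel {σ : R ≃+* R} {t : R} {a b : FreeAlgebra ℤ (GWAGen R)} (h : GWARel σ t a b) : mk σ t a = mk σ t b :=
  RingQuot.mkRingHom_rel h

/-- The generator `X`. -/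
def X : GWA σ t := mk σ t (FreeAlgebra.ι ℤ .X)

/-- The generator `Y`. -/
def Y : GWA σ t := mk σ t (FreeAlgebra.ι ℤ .Y)

/-- The structure map `R → A(t)`. -/
def incl : R →+* GWA σ t where
  toFun r := mk σ t (FreeAlgebra.ι ℤ (.coe r))
  map_one' := by rw [mk_rel .one, map_one]
  map_mul' r s := by rw [mk_rel (.mul r s), map_mul]
  map_zero' := by
    have h := mk_rel (σ := σ) (t := t) (.add 0 0)
    rw [map_add, add_zero] at h
    exact left_eq_add.mp h
  map_add' r s := by rw [mk_rel (.add r s), map_add]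

theorem X_incl (r : R) : X σ t * incl σ t r = incl σ t (σ r) * X σ t := by
  have h := mk_rel (σ := σ) (t := t) (.X_coe r)
  simp only [map_mul] at h
  exact h

theorem Y_incl (r : R) : Y σ t * incl σ t r = incl σ t (σ.symm r) * Y σ t := by
  have h := mk_rel (σ := σ) (t := t) (.Y_coe r)
  simp only [map_mul] at h
  exact h

theorem Y_X : Y σ t * X σ t = incl σ t t := by
  have h := mk_rel (σ := σ) (t := t) .Y_X
  simp only [map_mul] at h
  exact h

theorem X_Y : X σ t * Y σ t = incl σ t (σ t) := by
  have h := mk_rel (σ := σ) (t := t) .X_Y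
  simp only [map_mul] at h
  exact h

/-- `A(t)` as a left `R`-module, so that `IsScalarTower R A(t) V` says that the `R`-module
structure of an `A(t)`-module `V` is the one obtained by restriction along `R → A(t)`. -/
instance : Module R (GWA σ t) := Module.compHom _ (incl σ t)

theorem smul_def (r : R) (a : GWA σ t) : r • a = incl σ t r * a := rfl

variable {V W : Type} [AddCommGroup V] [Module R V] [AddCommGroup W] [Module R W]

section modules
variable [Module (GWA σ t) V] [IsScalarTower R (GWA σ t) V]
  [Module (GWA σ t) W] [IsScalarTower R (GWA σ t) W]

theorem incl_smul (r : R) (v : V) : incl σ t r • v = r • v := by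
  have h := smul_assoc r (1 : GWA σ t) v
  rwa [smul_def, mul_one, one_smul] at h

/-- The action of `X`, a `σ`-semilinear map. -/
def actX : V →ₛₗ[(σ : R →+* R)] V where
  toFun v := X σ t • v
  map_add' := smul_add _
  map_smul' r v := by
    rw [← incl_smul σ t, ← mul_smul, X_incl, mul_smul, incl_smul]; rfl

/-- The action of `Y`, a `σ⁻¹`-semilinear map. -/
def actY : V →ₛₗ[(σ.symm : R →+* R)] V where
  toFun v := Y σ t • v
  map_add' := smul_add _
  map_smul' r v := by
    rw [← incl_smul σ t, ← mul_smul, Y_incl, mul_smul, incl_smul]; rfl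

theorem actY_actX (v : V) : actY σ t (actX σ t v) = t • v := by
  change Y σ t • X σ t • v = _
  rw [← mul_smul, Y_X, incl_smul]

theorem actX_actY (v : V) : actX σ t (actY σ t v) = σ t • v := by
  change X σ t • Y σ t • v = _
  rw [← mul_smul, X_Y, incl_smul]

/-- An `A(t)`-linear map is `R`-linear. -/
def restrict (f : V →ₗ[GWA σ t] W) : V →ₗ[R] W where
  toFun := f
  map_add' := map_add f
  map_smul' r v := by
    rw [← incl_smul σ t, map_smul, incl_smul]; rfl

end modules

section hom

variable {σ : R ≃+* R} {t : R}
  [Module (GWA σ t) V] [IsScalarTower R (GWA σ t) V]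
  [Module (GWA σ t) W] [IsScalarTower R (GWA σ t) W]

/-- An `R`-linear map that commutes with `X` and `Y` is `A(t)`-linear. -/
def linearMapOf (f : V →ₗ[R] W) (hX : ∀ v, f (X σ t • v) = X σ t • f v)
    (hY : ∀ v, f (Y σ t • v) = Y σ t • f v) : V →ₗ[GWA σ t] W where
  toFun := f
  map_add' := map_add f
  map_smul' a v := by
    obtain ⟨a, rfl⟩ := mk_surjective σ t a
    induction a using FreeAlgebra.induction generalizing v with
    | grade0 n => simp [Int.cast_smul_eq_zsmul]
    | grade1 x =>
      cases x with
      | coe r =>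
        change f (incl σ t r • v) = incl σ t r • f v
        rw [incl_smul, incl_smul, map_smul]
      | X => exact hX v
      | Y => exact hY v
    | mul a b ha hb => simp only [map_mul, mul_smul, RingHom.id_apply] at *; rw [ha, hb]
    | add a b ha hb => simp only [map_add, add_smul, RingHom.id_apply] at *; rw [ha, hb]

/-- An `R`-linear equivalence that commutes with `X` and `Y` is `A(t)`-linear. -/
def linearEquivOf (f : V ≃ₗ[R] W) (hX : ∀ v, f (X σ t • v) = X σ t • f v)
    (hY : ∀ v, f (Y σ t • v) = Y σ t • f v) : V ≃ₗ[GWA σ t] W :=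
  { linearMapOf f.toLinearMap hX hY with
    invFun := f.symm
    left_inv := f.left_inv
    right_inv := f.right_inv }

end hom

section ofAction
variable {σ t}

/-- Operators satisfying the defining relations give a representation of `A(t)`. -/
def rep (x : V →ₛₗ[(σ : R →+* R)] V) (y : V →ₛₗ[(σ.symm : R →+* R)] V)
    (hyx : ∀ v, y (x v) = t • v) (hxy : ∀ v, x (y v) = σ t • v) :
    GWA σ t →+* AddMonoid.End V :=
  RingQuot.lift ⟨((FreeAlgebra.lift ℤ (fun g : GWAGen R => match g with
    | .coe r => (DistribSMul.toAddMonoidHom V r : AddMonoid.End V)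
    | .X => (x.toAddMonoidHom : AddMonoid.End V)
    | .Y => (y.toAddMonoidHom : AddMonoid.End V)) :
      FreeAlgebra ℤ (GWAGen R) →ₐ[ℤ] AddMonoid.End V) :
      FreeAlgebra ℤ (GWAGen R) →+* AddMonoid.End V), by
    intro a b h
    cases h <;> refine AddMonoidHom.ext fun v => ?_ <;>
      simp only [RingHom.coe_coe, map_mul, map_add, map_one, FreeAlgebra.lift_ι_apply]
    case one => exact one_smul R v
    case add r s => exact add_smul r s v
    case mul r s => exact mul_smul r s v
    case X_coe r => exact x.map_smulₛₗ r v
    case Y_coe r => exact y.map_smulₛₗ r v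
    case Y_X => exact hyx v
    case X_Y => exact hxy v⟩

/-- The `A(t)`-module structure given by operators satisfying the defining relations. -/
abbrev moduleOf (x : V →ₛₗ[(σ : R →+* R)] V) (y : V →ₛₗ[(σ.symm : R →+* R)] V)
    (hyx : ∀ v, y (x v) = t • v) (hxy : ∀ v, x (y v) = σ t • v) :
    Module (GWA σ t) V := Module.compHom V (rep x y hyx hxy)

variable (x : V →ₛₗ[(σ : R →+* R)] V) (y : V →ₛₗ[(σ.symm : R →+* R)] V)
  (hyx : ∀ v, y (x v) = t • v) (hxy : ∀ v, x (y v) = σ t • v)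

theorem moduleOf_incl (r : R) (v : V) :
    letI := moduleOf x y hyx hxy
    incl σ t r • v = r • v := by
  change rep x y hyx hxy (incl σ t r) v = _
  unfold rep
  erw [RingQuot.lift_mkRingHom_apply]
  rw [RingHom.coe_coe, FreeAlgebra.lift_ι_apply]
  rfl

theorem moduleOf_X (v : V) :
    letI := moduleOf x y hyx hxy
    X σ t • v = x v := by
  change rep x y hyx hxy (X σ t) v = _
  unfold rep
  erw [RingQuot.lift_mkRingHom_apply]
  rw [RingHom.coe_coe, FreeAlgebra.lift_ι_apply]
  rfl

theorem moduleOf_Y (v : V) :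
    letI := moduleOf x y hyx hxy
    Y σ t • v = y v := by
  change rep x y hyx hxy (Y σ t) v = _
  unfold rep
  erw [RingQuot.lift_mkRingHom_apply]
  rw [RingHom.coe_coe, FreeAlgebra.lift_ι_apply]
  rfl

theorem moduleOf_tower :
    letI := moduleOf x y hyx hxy
    IsScalarTower R (GWA σ t) V := by
  let := moduleOf x y hyx hxy
  refine ⟨fun r a v => ?_⟩
  rw [smul_def, mul_smul, moduleOf_incl x y hyx hxy]

end ofAction

end GWA

/-! ### Weight modules -/

section weight
variable (R : Type) [CommRing R] (V W : Type) [AddCommGroup V] [Module R V]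
  [AddCommGroup W] [Module R W]

/-- The weight space `V_𝔪 = {v | 𝔪 v = 0}`. -/
abbrev weightSpace (m : MaximalSpectrum R) : Submodule R V :=
  Submodule.torsionBySet R V (m.asIdeal : Set R)

open Classical in
/-- `V` is the direct sum of its weight spaces. -/
def IsWeight : Prop := DirectSum.IsInternal (weightSpace R V)

/-- `V` is a weight module with support in `ω` and finite-dimensional weight spaces. -/
structure IsFinWeightOn (ω : Set (MaximalSpectrum R)) : Prop where
  isWeight : IsWeight R V
  finite : ∀ m : MaximalSpectrum R, Module.Finite (R ⧸ m.asIdeal) (weightSpace R V m)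
  supp : ∀ m : MaximalSpectrum R, weightSpace R V m ≠ ⊥ → m ∈ ω

variable {R V W}

theorem weightSpace_indep : iSupIndep (weightSpace R V) := by
  classical
  rw [iSupIndep_iff_supIndep]
  intro s
  exact Submodule.supIndep_torsionBySet_ideal (p := fun m : MaximalSpectrum R => m.asIdeal)
    fun i _ j _ hij => Ideal.isCoprime_iff_sup_eq.mp
      (Ideal.isCoprime_of_isMaximal fun h => hij (MaximalSpectrum.ext h))

theorem isWeight_iff : IsWeight R V ↔ ⨆ m, weightSpace R V m = ⊤ := by
  classical
  unfold IsWeight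
  rw [DirectSum.isInternal_submodule_iff_iSupIndep_and_iSup_eq_top]
  exact ⟨fun h => h.2, fun h => ⟨weightSpace_indep, h⟩⟩

theorem IsWeight.isSemisimpleModule (h : IsWeight R V) : IsSemisimpleModule R V := by
  refine isSemisimpleModule_of_isSemisimpleModule_submodule' (p := weightSpace R V) (fun m => ?_)
    (isWeight_iff.mp h)
  let := Ideal.Quotient.field m.asIdeal
  have : IsSemisimpleModule (R ⧸ m.asIdeal) (weightSpace R V m) := inferInstance
  exact (LinearMap.isSemisimpleModule_iff_of_bijective
    (σ := Ideal.Quotient.mk m.asIdeal)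
    { toFun := id, map_add' := fun _ _ => rfl, map_smul' := fun _ _ => rfl }
    Function.bijective_id).mpr this

/-- Subspaces of the weight spaces that span a weight module are the weight spaces. -/
theorem weightSpace_eq (P : MaximalSpectrum R → Submodule R V) (hP : ∀ m, P m ≤ weightSpace R V m)
    (h : ⨆ m, P m = ⊤) (m : MaximalSpectrum R) : weightSpace R V m = P m := by
  refine le_antisymm (fun v hv => ?_) (hP m)
  have hv' : v ∈ P m ⊔ ⨆ (j) (_ : j ≠ m), P j := by
    have : v ∈ (⊤ : Submodule R V) := trivial
    rw [← h] at this
    refine (iSup_le fun j => ?_ : ⨆ j, P j ≤ P m ⊔ ⨆ (j) (_ : j ≠ m), P j) this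
    by_cases hj : j = m
    · subst hj; exact le_sup_left
    · exact le_sup_of_le_right (le_iSup₂_of_le j hj le_rfl)
  obtain ⟨a, ha, b, hb, rfl⟩ := Submodule.mem_sup.mp hv'
  have hb1 : b ∈ weightSpace R V m := by
    simpa using Submodule.sub_mem _ hv (hP m ha)
  have hb2 : b ∈ ⨆ (j) (_ : j ≠ m), weightSpace R V j :=
    iSup₂_mono (fun j _ => hP j) hb
  have : b = 0 := Submodule.disjoint_def.mp (weightSpace_indep m) b hb1 hb2
  simpa [this] using ha

theorem finite_quot_iff (m : MaximalSpectrum R) :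
    Module.Finite (R ⧸ m.asIdeal) (weightSpace R V m) ↔ Module.Finite R (weightSpace R V m) := by
  constructor
  · intro h
    exact Module.Finite.trans (R ⧸ m.asIdeal) _
  · intro h
    exact Module.Finite.of_restrictScalars_finite R _ _

/-- The weight spaces of a tensor product. -/
def tensorWeight (R : Type) [CommRing R] (V W : Type) [AddCommGroup V] [Module R V]
    [AddCommGroup W] [Module R W] (m : MaximalSpectrum R) : Submodule R (V ⊗[R] W) :=
  LinearMap.range (TensorProduct.map (weightSpace R V m).subtype (weightSpace R W m).subtype)

theorem tensorWeight_le (m : MaximalSpectrum R) :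
    tensorWeight R V W m ≤ weightSpace R (V ⊗[R] W) m := by
  rintro _ ⟨x, rfl⟩
  rw [Submodule.mem_torsionBySet_iff]
  rintro ⟨a, ha⟩
  induction x with
  | zero => simp
  | add x y hx hy => rw [map_add, smul_add, hx, hy, add_zero]
  | tmul x y =>
    have : a • (x : V) = 0 := ((Submodule.mem_torsionBySet_iff _ _).mp x.2) ⟨a, ha⟩
    simp [TensorProduct.smul_tmul', this]

theorem iSup_tensorWeight (hV : IsWeight R V) (hW : IsWeight R W) :
    ⨆ m, tensorWeight R V W m = ⊤ := by
  rw [eq_top_iff]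
  rintro x -
  induction x with
  | zero => exact zero_mem _
  | add x y hx hy => exact add_mem hx hy
  | tmul v w =>
    have hv : v ∈ ⨆ m, weightSpace R V m := by rw [isWeight_iff.mp hV]; trivial
    have hw : w ∈ ⨆ m, weightSpace R W m := by rw [isWeight_iff.mp hW]; trivial
    induction hv using Submodule.iSup_induction' with
    | zero => simp
    | add x y _ _ hx hy => rw [TensorProduct.add_tmul]; exact add_mem hx hy
    | mem i v hv =>
      induction hw using Submodule.iSup_induction' with
      | zero => simp
      | add x y _ _ hx hy => rw [TensorProduct.tmul_add]; exact add_mem hx hy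
      | mem j w hw =>
        by_cases hij : i = j
        · subst hij
          exact Submodule.mem_iSup_of_mem i ⟨(⟨v, hv⟩ : weightSpace R V i) ⊗ₜ
            (⟨w, hw⟩ : weightSpace R W i), by simp⟩
        · have hc : IsCoprime i.asIdeal j.asIdeal :=
            Ideal.isCoprime_of_isMaximal fun h => hij (MaximalSpectrum.ext h)
          obtain ⟨a, ha, b, hb, hab⟩ := Ideal.isCoprime_iff_exists.mp hc
          have h1 : a • v = 0 := (Submodule.mem_torsionBySet_iff _ _).mp hv ⟨a, ha⟩
          have h2 : b • w = 0 := (Submodule.mem_torsionBySet_iff _ _).mp hw ⟨b, hb⟩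
          have : v ⊗ₜ[R] w = 0 := by
            rw [← one_smul R (v ⊗ₜ[R] w), ← hab, add_smul, TensorProduct.smul_tmul', h1,
              TensorProduct.zero_tmul, TensorProduct.smul_tmul', TensorProduct.smul_tmul, h2,
              TensorProduct.tmul_zero, add_zero]
          rw [this]; exact zero_mem _

theorem IsFinWeightOn.tensor {ω : Set (MaximalSpectrum R)} (hV : IsFinWeightOn R V ω)
    (hW : IsFinWeightOn R W ω) : IsFinWeightOn R (V ⊗[R] W) ω := by
  have hsup := iSup_tensorWeight hV.isWeight hW.isWeight
  have heq := weightSpace_eq _ tensorWeight_le hsup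
  refine ⟨isWeight_iff.mpr ?_, fun m => ?_, fun m hm => hV.supp m fun h => hm ?_⟩
  · rw [eq_top_iff, ← hsup]; exact iSup_mono tensorWeight_le
  · rw [finite_quot_iff, heq m]
    have := (finite_quot_iff m).mp (hV.finite m)
    have := (finite_quot_iff m).mp (hW.finite m)
    unfold tensorWeight
    infer_instance
  · rw [heq m, eq_bot_iff]
    rintro _ ⟨x, rfl⟩
    induction x with
    | zero => simp
    | add x y hx hy => rw [map_add]; exact add_mem hx hy
    | tmul x y =>
      have : (x : V) = 0 := by simpa [h] using x.2
      simp [this]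

theorem IsFinWeightOn.of_subsingleton [Subsingleton V] (ω : Set (MaximalSpectrum R)) :
    IsFinWeightOn R V ω :=
  ⟨isWeight_iff.mpr (Subsingleton.elim _ _), fun _ => inferInstance,
    fun _ h => (h (Subsingleton.elim _ _)).elim⟩

/-- The module `R ⧸ ⋂ ω ≅ ⨁_{𝔪 ∈ ω} R ⧸ 𝔪`, for a finite set `ω` of maximal ideals. -/
theorem IsFinWeightOn.quot {ω : Set (MaximalSpectrum R)} (hω : ω.Finite) :
    IsFinWeightOn R (R ⧸ ⨅ m ∈ ω, m.asIdeal) ω := by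
  have h0 : ⨆ m ∈ ω, weightSpace R (R ⧸ ⨅ m ∈ ω, m.asIdeal) m = ⊤ := by
    have := Submodule.iSup_torsionBySet_ideal_eq_torsionBySet_iInf
      (M := R ⧸ ⨅ m ∈ ω, m.asIdeal) (S := hω.toFinset)
      (p := fun m : MaximalSpectrum R => m.asIdeal)
      fun i _ j _ hij => Ideal.isCoprime_iff_sup_eq.mp
      (Ideal.isCoprime_of_isMaximal fun h => hij (MaximalSpectrum.ext h))
    simp only [Set.Finite.mem_toFinset] at this
    rw [this, eq_top_iff]
    rintro x -
    rw [Submodule.mem_torsionBySet_iff]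
    rintro ⟨a, ha⟩
    obtain ⟨x, rfl⟩ := Ideal.Quotient.mk_surjective x
    change Ideal.Quotient.mk _ (a * x) = 0
    rw [Ideal.Quotient.eq_zero_iff_mem]
    exact Ideal.mul_mem_right _ _ ha
  have hw : IsWeight R (R ⧸ ⨅ m ∈ ω, m.asIdeal) := by
    rw [isWeight_iff, eq_top_iff, ← h0]
    exact iSup_mono fun m => iSup_le fun _ => le_rfl
  have := hw.isSemisimpleModule
  refine ⟨hw, fun m => ?_, fun m hm => ?_⟩
  · rw [finite_quot_iff]
    infer_instance
  · by_contra hmω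
    refine hm (disjoint_self.mp ((weightSpace_indep (R := R) m).mono_right ?_))
    refine le_trans le_top ?_
    rw [← h0]
    exact iSup_mono fun j => iSup_le fun hj => le_iSup_of_le (by rintro rfl; exact hmω hj) le_rfl

/-- An injective `R`-linear map into a weight module splits. -/
theorem IsWeight.exists_retraction (h : IsWeight R W) (f : V →ₗ[R] W)
    (hf : Function.Injective f) : ∃ g : W →ₗ[R] V, g ∘ₗ f = LinearMap.id := by
  have := h.isSemisimpleModule
  exact IsSemisimpleModule.extension_property f hf LinearMap.id

end weight

section category
variable {R : Type} [CommRing R]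

/-- `ω` is a finite orbit of maximal ideals under the action of `σ`. -/
class IsFiniteOrbit (σ : R ≃+* R) (ω : Set (MaximalSpectrum R)) : Prop where
  finite : ω.Finite
  orbit : ∃ m₀ ∈ ω, ω = {m | ∃ n : ℤ, m.asIdeal = m₀.asIdeal.map (σ ^ n : R ≃+* R)}

/-- Objects of `A(t)-wmod_ω`: weight modules over `A(t)` with finite-dimensional weight spaces and
support in `ω`. The `R`-module structure is the restriction of the `A(t)`-module structure.
Morphisms are the `A(t)`-linear maps. -/
structure WMod (σ : R ≃+* R) (ω : Set (MaximalSpectrum R)) (t : R) where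
  carrier : Type
  [addCommGroup : AddCommGroup carrier]
  [moduleBase : Module R carrier]
  [module : Module (GWA σ t) carrier]
  [tower : IsScalarTower R (GWA σ t) carrier]
  isFinWeightOn : IsFinWeightOn R carrier ω

namespace WMod

variable {σ : R ≃+* R} {ω : Set (MaximalSpectrum R)} {t t' : R}

instance : CoeSort (WMod σ ω t) Type := ⟨WMod.carrier⟩

attribute [instance] addCommGroup moduleBase module tower

/-- The zero module. -/
def zero (σ : R ≃+* R) (ω : Set (MaximalSpectrum R)) (t : R) : WMod σ ω t :=
  letI : Module (GWA σ t) PUnit.{1} := inferInstance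
  haveI : IsScalarTower R (GWA σ t) PUnit.{1} := ⟨fun _ _ _ => rfl⟩
  { carrier := PUnit.{1}
    isFinWeightOn := .of_subsingleton ω }

/-- The tensor product `M ⊗_R N` of an `A(t)`-module and an `A(t')`-module, as a module over
`A(t t')`: here `X` acts by `X ⊗ X` and `Y` acts by `Y ⊗ Y`. -/
def tensor (M : WMod σ ω t) (N : WMod σ ω t') : WMod σ ω (t * t') :=
  letI x : (M ⊗[R] N) →ₛₗ[(σ : R →+* R)] (M ⊗[R] N) :=
    TensorProduct.map (GWA.actX σ t) (GWA.actX σ t')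
  letI y : (M ⊗[R] N) →ₛₗ[(σ.symm : R →+* R)] (M ⊗[R] N) :=
    TensorProduct.map (GWA.actY σ t) (GWA.actY σ t')
  have hyx : ∀ v, y (x v) = (t * t') • v := fun v => by
    induction v with
    | zero => simp
    | add a b ha hb => rw [map_add, map_add, ha, hb, smul_add]
    | tmul a b =>
      simp only [x, y, TensorProduct.map_tmul, GWA.actY_actX, TensorProduct.smul_tmul_smul]
  have hxy : ∀ v, x (y v) = σ (t * t') • v := fun v => by
    induction v with
    | zero => simp
    | add a b ha hb => rw [map_add, map_add, ha, hb, smul_add]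
    | tmul a b =>
      simp only [x, y, TensorProduct.map_tmul, GWA.actX_actY, TensorProduct.smul_tmul_smul, map_mul]
  { carrier := M ⊗[R] N
    module := GWA.moduleOf x y hyx hxy
    tower := GWA.moduleOf_tower x y hyx hxy
    isFinWeightOn := M.isFinWeightOn.tensor N.isFinWeightOn }

/-- The action of `X` on `M`. -/
def actX (M : WMod σ ω t) : M →ₛₗ[(σ : R →+* R)] M := GWA.actX σ t

/-- The action of `Y` on `M`. -/
def actY (M : WMod σ ω t) : M →ₛₗ[(σ.symm : R →+* R)] M := GWA.actY σ t

theorem tensor_X (M : WMod σ ω t) (N : WMod σ ω t') (v : M ⊗[R] N) :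
    (tensor M N).actX v = TensorProduct.map M.actX N.actX v :=
  GWA.moduleOf_X (V := M ⊗[R] N) ..

theorem tensor_Y (M : WMod σ ω t) (N : WMod σ ω t') (v : M ⊗[R] N) :
    (tensor M N).actY v = TensorProduct.map M.actY N.actY v :=
  GWA.moduleOf_Y (V := M ⊗[R] N) ..

theorem smul_eq_zero (M : WMod σ ω t) {a : R} (ha : a ∈ ⨅ m ∈ ω, m.asIdeal) (v : M) :
    a • v = 0 := by
  have hv : v ∈ ⨆ m, weightSpace R M m := by
    rw [isWeight_iff.mp M.isFinWeightOn.isWeight]; trivial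
  induction hv using Submodule.iSup_induction' with
  | zero => simp
  | add x y _ _ hx hy => rw [smul_add, hx, hy, add_zero]
  | mem m v hv =>
    by_cases h0 : weightSpace R M m = ⊥
    · rw [h0] at hv; simp [(Submodule.mem_bot R).mp hv]
    · have hm := M.isFinWeightOn.supp m h0
      simp only [Ideal.mem_iInf] at ha
      exact (Submodule.mem_torsionBySet_iff _ _).mp hv ⟨a, ha m hm⟩

section unit

variable (σ : R ≃+* R) (ω : Set (MaximalSpectrum R)) [h : IsFiniteOrbit σ ω]

theorem mem_iInf_orbit (n : ℤ) {a : R} (ha : a ∈ ⨅ m ∈ ω, m.asIdeal) :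
    (σ ^ n : R ≃+* R) a ∈ ⨅ m ∈ ω, m.asIdeal := by
  obtain ⟨m₀, -, hω⟩ := h.orbit
  simp only [Ideal.mem_iInf] at ha ⊢
  intro m hm
  obtain ⟨k, hk⟩ : ∃ n : ℤ, m.asIdeal = m₀.asIdeal.map (σ ^ n : R ≃+* R) := by
    rw [hω] at hm; exact hm
  let m' : MaximalSpectrum R := ⟨m₀.asIdeal.map (σ ^ (k - n) : R ≃+* R),
    Ideal.map_isMaximal_of_equiv _⟩
  have hm' : m' ∈ ω := by rw [hω]; exact ⟨_, rfl⟩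
  have h1 := ha m' hm'
  obtain ⟨b, hb, rfl⟩ := (Ideal.mem_map_of_equiv _ _).mp h1
  rw [hk]
  refine (Ideal.mem_map_of_equiv _ _).mpr ⟨b, hb, ?_⟩
  rw [← RingAut.mul_apply, ← zpow_add]
  congr 2
  ring

/-- The unit object `R ⧸ ⋂ ω ≅ ⨁_{𝔪 ∈ ω} R ⧸ 𝔪` over `A(1)`: here `X` acts by `σ` and `Y` acts
by `σ⁻¹`. -/
def unit : WMod σ ω 1 :=
  letI I : Ideal R := ⨅ m ∈ ω, m.asIdeal
  letI x : (R ⧸ I) →ₛₗ[(σ : R →+* R)] (R ⧸ I) :=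
    { toFun := Ideal.quotientMap I (σ : R →+* R) fun a ha => by
        exact mem_iInf_orbit σ ω 1 ha
      map_add' := map_add _
      map_smul' := fun r v => by
        obtain ⟨v, rfl⟩ := Ideal.Quotient.mk_surjective v
        exact congrArg (Ideal.Quotient.mk I) (map_mul σ r v) }
  letI y : (R ⧸ I) →ₛₗ[(σ.symm : R →+* R)] (R ⧸ I) :=
    { toFun := Ideal.quotientMap I (σ.symm : R →+* R) fun a ha => by
        exact mem_iInf_orbit σ ω (-1) ha
      map_add' := map_add _
      map_smul' := fun r v => by
        obtain ⟨v, rfl⟩ := Ideal.Quotient.mk_surjective v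
        exact congrArg (Ideal.Quotient.mk I) (map_mul σ.symm r v) }
  have hyx : ∀ v, y (x v) = (1 : R) • v := fun v => by
    obtain ⟨v, rfl⟩ := Ideal.Quotient.mk_surjective v
    rw [one_smul]
    exact congrArg (Ideal.Quotient.mk I) (σ.symm_apply_apply v)
  have hxy : ∀ v, x (y v) = σ (1 : R) • v := fun v => by
    obtain ⟨v, rfl⟩ := Ideal.Quotient.mk_surjective v
    rw [map_one, one_smul]
    exact congrArg (Ideal.Quotient.mk I) (σ.apply_symm_apply v)
  { carrier := R ⧸ I
    module := GWA.moduleOf x y hyx hxy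
    tower := GWA.moduleOf_tower x y hyx hxy
    isFinWeightOn := .quot h.finite }

theorem unit_X (a : R) : (unit σ ω).actX (Ideal.Quotient.mk (⨅ m ∈ ω, m.asIdeal) a) =
    (Ideal.Quotient.mk _ (σ a) : unit σ ω) :=
  GWA.moduleOf_X (V := R ⧸ ⨅ m ∈ ω, m.asIdeal) ..

theorem unit_Y (a : R) : (unit σ ω).actY (Ideal.Quotient.mk (⨅ m ∈ ω, m.asIdeal) a) =
    (Ideal.Quotient.mk _ (σ.symm a) : unit σ ω) :=
  GWA.moduleOf_Y (V := R ⧸ ⨅ m ∈ ω, m.asIdeal) ..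

end unit

section unit

variable [h : IsFiniteOrbit σ ω]

/-- The left unit isomorphism. -/
def unitTensor (M : WMod σ ω t) : (tensor (unit σ ω) M) ≃ₗ[R] M :=
  (TensorProduct.quotTensorEquivQuotSMul M (⨅ m ∈ ω, m.asIdeal)).trans
    (Submodule.quotEquivOfEqBot _ (by
      rw [eq_bot_iff, Submodule.smul_le]
      intro a ha v _
      exact (Submodule.mem_bot R).mpr (smul_eq_zero M ha v)))

theorem unitTensor_tmul (M : WMod σ ω t) (a : R) (v : M) :
    unitTensor M (Ideal.Quotient.mk (⨅ m ∈ ω, m.asIdeal) a ⊗ₜ[R] v) = a • v := by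
  rfl

end unit

end WMod
end category

section groth
variable {R : Type} [CommRing R]

/-- The two kinds of Grothendieck group: with relations from all short exact sequences, or only
from direct sum decompositions. -/
inductive K0Kind
  | all
  | split

variable {σ : R ≃+* R} {ω : Set (MaximalSpectrum R)} {t t' : R}

/-- `[M] = [M'] + [M'']` is a defining relation of the Grothendieck group: for the ordinary one, if
there is a short exact sequence `0 → M' → M → M'' → 0`, and for the split one, if
`M ≅ M' ⊕ M''`. -/
def K0Rel : K0Kind → WMod σ ω t → WMod σ ω t → WMod σ ω t → Prop
  | .all, M', M, M'' => ∃ (f : M' →ₗ[GWA σ t] M) (g : M →ₗ[GWA σ t] M''),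
      Function.Injective f ∧ Function.Exact f g ∧ Function.Surjective g
  | .split, M', M, M'' => Nonempty (M ≃ₗ[GWA σ t] M' × M'')

theorem K0Rel.ofSplit {M' M M'' : WMod σ ω t} (h : K0Rel .split M' M M'') (k : K0Kind) :
    K0Rel k M' M M'' := by
  cases k with
  | split => exact h
  | all =>
    obtain ⟨e⟩ := h
    refine ⟨e.symm.toLinearMap ∘ₗ LinearMap.inl _ _ _, LinearMap.snd _ _ _ ∘ₗ e.toLinearMap,
      ?_, ?_, ?_⟩
    · exact e.symm.injective.comp LinearMap.inl_injective
    · intro x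
      constructor
      · intro hx
        exact ⟨(e x).1, by
          apply e.injective
          simp only [LinearMap.comp_apply, LinearEquiv.coe_coe, LinearEquiv.apply_symm_apply]
          exact Prod.ext rfl (by simpa using hx.symm)⟩
      · rintro ⟨y, rfl⟩
        simp
    · exact (LinearMap.snd_surjective (R := GWA σ t) (M := M') (M₂ := M'')).comp e.surjective

theorem restrict_X {A B : WMod σ ω t} (f : A →ₗ[GWA σ t] B) (v : A) :
    GWA.restrict σ t f (A.actX v) = B.actX (GWA.restrict σ t f v) := map_smul f _ _

theorem restrict_Y {A B : WMod σ ω t} (f : A →ₗ[GWA σ t] B) (v : A) :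
    GWA.restrict σ t f (A.actY v) = B.actY (GWA.restrict σ t f v) := map_smul f _ _

theorem exists_rTensor {A B : WMod σ ω t} (f : A →ₗ[GWA σ t] B) (N : WMod σ ω t') :
    ∃ F : (A.tensor N) →ₗ[GWA σ (t * t')] (B.tensor N),
      ⇑F = ⇑(LinearMap.rTensor N (GWA.restrict σ t f)) := by
  let F₀ : (A.tensor N) →ₗ[R] (B.tensor N) := LinearMap.rTensor N (GWA.restrict σ t f)
  have hX : ∀ v : A ⊗[R] N, LinearMap.rTensor N (GWA.restrict σ t f)
      (TensorProduct.map A.actX N.actX v) =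
      TensorProduct.map B.actX N.actX (LinearMap.rTensor N (GWA.restrict σ t f) v) := fun v => by
    induction v with
    | zero => simp
    | add a b ha hb => simp only [map_add, ha, hb]
    | tmul a b => simp [restrict_X]
  have hY : ∀ v : A ⊗[R] N, LinearMap.rTensor N (GWA.restrict σ t f)
      (TensorProduct.map A.actY N.actY v) =
      TensorProduct.map B.actY N.actY (LinearMap.rTensor N (GWA.restrict σ t f) v) := fun v => by
    induction v with
    | zero => simp
    | add a b ha hb => simp only [map_add, ha, hb]
    | tmul a b => simp [restrict_Y]
  exact ⟨GWA.linearMapOf F₀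
    (fun v => (congrArg F₀ (WMod.tensor_X A N v)).trans ((hX v).trans (WMod.tensor_X B N _).symm))
    (fun v => (congrArg F₀ (WMod.tensor_Y A N v)).trans ((hY v).trans (WMod.tensor_Y B N _).symm)),
    rfl⟩

theorem exists_lTensor {A B : WMod σ ω t} (f : A →ₗ[GWA σ t] B) (N : WMod σ ω t') :
    ∃ F : (N.tensor A) →ₗ[GWA σ (t' * t)] (N.tensor B),
      ⇑F = ⇑(LinearMap.lTensor N (GWA.restrict σ t f)) := by
  let F₀ : (N.tensor A) →ₗ[R] (N.tensor B) := LinearMap.lTensor N (GWA.restrict σ t f)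
  have hX : ∀ v : N ⊗[R] A, LinearMap.lTensor N (GWA.restrict σ t f)
      (TensorProduct.map N.actX A.actX v) =
      TensorProduct.map N.actX B.actX (LinearMap.lTensor N (GWA.restrict σ t f) v) := fun v => by
    induction v with
    | zero => simp
    | add a b ha hb => simp only [map_add, ha, hb]
    | tmul a b => simp [restrict_X]
  have hY : ∀ v : N ⊗[R] A, LinearMap.lTensor N (GWA.restrict σ t f)
      (TensorProduct.map N.actY A.actY v) =
      TensorProduct.map N.actY B.actY (LinearMap.lTensor N (GWA.restrict σ t f) v) := fun v => by
    induction v with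
    | zero => simp
    | add a b ha hb => simp only [map_add, ha, hb]
    | tmul a b => simp [restrict_Y]
  exact ⟨GWA.linearMapOf F₀
    (fun v => (congrArg F₀ (WMod.tensor_X N A v)).trans ((hX v).trans (WMod.tensor_X N B _).symm))
    (fun v => (congrArg F₀ (WMod.tensor_Y N A v)).trans ((hY v).trans (WMod.tensor_Y N B _).symm)),
    rfl⟩

/-- An `A(t)`-linear decomposition is `R`-linear. -/
def restrictProd {M' M M'' : WMod σ ω t} (e : M ≃ₗ[GWA σ t] M' × M'') : M ≃ₗ[R] M' × M'' :=
  { (GWA.restrict σ t (LinearMap.fst _ _ _ ∘ₗ e.toLinearMap)).prod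
      (GWA.restrict σ t (LinearMap.snd _ _ _ ∘ₗ e.toLinearMap)) with
    invFun := e.symm
    left_inv := e.left_inv
    right_inv := e.right_inv }

theorem K0Rel.tensor_right {k : K0Kind} {M' M M'' : WMod σ ω t} (h : K0Rel k M' M M'')
    (N : WMod σ ω t') : K0Rel k (M'.tensor N) (M.tensor N) (M''.tensor N) := by
  cases k with
  | all =>
    obtain ⟨f, g, hf, hfg, hg⟩ := h
    obtain ⟨F, hF⟩ := exists_rTensor f N
    obtain ⟨G, hG⟩ := exists_rTensor g N
    refine ⟨F, G, ?_, ?_, ?_⟩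
    · obtain ⟨r, hr⟩ := M.isFinWeightOn.isWeight.exists_retraction (GWA.restrict σ t f) hf
      rw [hF]
      refine Function.LeftInverse.injective (g := LinearMap.rTensor N r) fun x => ?_
      rw [← LinearMap.comp_apply, ← LinearMap.rTensor_comp, hr, LinearMap.rTensor_id]; rfl
    · rw [hF, hG]
      exact rTensor_exact N (f := GWA.restrict σ t f) (g := GWA.restrict σ t g) hfg hg
    · rw [hG]
      exact LinearMap.rTensor_surjective N (g := GWA.restrict σ t g) hg
  | split =>
    obtain ⟨e⟩ := h
    obtain ⟨F, hF⟩ := exists_rTensor (LinearMap.fst _ _ _ ∘ₗ e.toLinearMap) N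
    obtain ⟨G, hG⟩ := exists_rTensor (LinearMap.snd _ _ _ ∘ₗ e.toLinearMap) N
    refine ⟨LinearEquiv.ofBijective (F.prod G) ?_⟩
    let E := (LinearEquiv.rTensor N (restrictProd e)).trans (TensorProduct.prodLeft R R M' M'' N)
    have hE : ∀ x : M ⊗[R] N, (LinearMap.rTensor N
          (GWA.restrict σ t (LinearMap.fst _ _ _ ∘ₗ e.toLinearMap)) x,
        LinearMap.rTensor N
          (GWA.restrict σ t (LinearMap.snd _ _ _ ∘ₗ e.toLinearMap)) x) = E x := by
      intro x
      induction x with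
      | zero => simp
      | add a b ha hb => rw [map_add, map_add, map_add, ← ha, ← hb]; rfl
      | tmul a b => rfl
    have : ⇑(F.prod G) = ⇑E := by
      funext x
      rw [← hE x]
      exact Prod.ext (congrFun hF x) (congrFun hG x)
    rw [this]
    exact E.bijective

theorem K0Rel.tensor_left {k : K0Kind} {M' M M'' : WMod σ ω t} (h : K0Rel k M' M M'')
    (N : WMod σ ω t') : K0Rel k (N.tensor M') (N.tensor M) (N.tensor M'') := by
  cases k with
  | all =>
    obtain ⟨f, g, hf, hfg, hg⟩ := h
    obtain ⟨F, hF⟩ := exists_lTensor f N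
    obtain ⟨G, hG⟩ := exists_lTensor g N
    refine ⟨F, G, ?_, ?_, ?_⟩
    · obtain ⟨r, hr⟩ := M.isFinWeightOn.isWeight.exists_retraction (GWA.restrict σ t f) hf
      rw [hF]
      refine Function.LeftInverse.injective (g := LinearMap.lTensor N r) fun x => ?_
      rw [← LinearMap.comp_apply, ← LinearMap.lTensor_comp, hr, LinearMap.lTensor_id]; rfl
    · rw [hF, hG]
      exact lTensor_exact N (f := GWA.restrict σ t f) (g := GWA.restrict σ t g) hfg hg
    · rw [hG]
      exact LinearMap.lTensor_surjective N (g := GWA.restrict σ t g) hg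
  | split =>
    obtain ⟨e⟩ := h
    obtain ⟨F, hF⟩ := exists_lTensor (LinearMap.fst _ _ _ ∘ₗ e.toLinearMap) N
    obtain ⟨G, hG⟩ := exists_lTensor (LinearMap.snd _ _ _ ∘ₗ e.toLinearMap) N
    refine ⟨LinearEquiv.ofBijective (F.prod G) ?_⟩
    let E := (LinearEquiv.lTensor N (restrictProd e)).trans (TensorProduct.prodRight R R N M' M'')
    have hE : ∀ x : N ⊗[R] M, (LinearMap.lTensor N
          (GWA.restrict σ t (LinearMap.fst _ _ _ ∘ₗ e.toLinearMap)) x,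
        LinearMap.lTensor N
          (GWA.restrict σ t (LinearMap.snd _ _ _ ∘ₗ e.toLinearMap)) x) = E x := by
      intro x
      induction x with
      | zero => simp
      | add a b ha hb => rw [map_add, map_add, map_add, ← ha, ← hb]; rfl
      | tmul a b => rfl
    have : ⇑(F.prod G) = ⇑E := by
      funext x
      rw [← hE x]
      exact Prod.ext (congrFun hF x) (congrFun hG x)
    rw [this]
    exact E.bijective

theorem K0Rel.ofEquiv (k : K0Kind) {M N : WMod σ ω t} (e : M ≃ₗ[GWA σ t] N) :
    K0Rel k N M (WMod.zero σ ω t) := by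
  let : Unique (WMod.zero σ ω t) := inferInstanceAs (Unique PUnit.{1})
  exact K0Rel.ofSplit ⟨e.trans (LinearEquiv.prodUnique (R := GWA σ t) (M := N)
    (M₂ := WMod.zero σ ω t)).symm⟩ k

/-! ### Grothendieck groups -/

/-- The defining relations of the Grothendieck group. -/
def K0Relations (k : K0Kind) (σ : R ≃+* R) (ω : Set (MaximalSpectrum R)) (t : R) :
    AddSubgroup (FreeAbelianGroup (WMod σ ω t)) :=
  AddSubgroup.closure {x | ∃ M' M M'' : WMod σ ω t, K0Rel k M' M M'' ∧
    x = FreeAbelianGroup.of M - (FreeAbelianGroup.of M' + FreeAbelianGroup.of M'')}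

/-- The Grothendieck group (`k = .all`) or the split Grothendieck group (`k = .split`) of
`A(t)-wmod_ω`. -/
def K0 (k : K0Kind) (σ : R ≃+* R) (ω : Set (MaximalSpectrum R)) (t : R) : Type 1 :=
  FreeAbelianGroup (WMod σ ω t) ⧸ K0Relations k σ ω t

namespace K0

variable {k : K0Kind}

instance : AddCommGroup (K0 k σ ω t) :=
  inferInstanceAs (AddCommGroup (FreeAbelianGroup (WMod σ ω t) ⧸ K0Relations k σ ω t))

/-- The class of a module. -/
def cls (k : K0Kind) (M : WMod σ ω t) : K0 k σ ω t :=
  QuotientAddGroup.mk' (K0Relations k σ ω t) (FreeAbelianGroup.of M)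

theorem cls_rel {M' M M'' : WMod σ ω t} (h : K0Rel k M' M M'') :
    cls k M = cls k M' + cls k M'' := by
  have : QuotientAddGroup.mk' (K0Relations k σ ω t) (FreeAbelianGroup.of M -
      (FreeAbelianGroup.of M' + FreeAbelianGroup.of M'')) = 0 :=
    (QuotientAddGroup.eq_zero_iff _).mpr (AddSubgroup.subset_closure ⟨M', M, M'', h, rfl⟩)
  rw [map_sub, map_add, sub_eq_zero] at this
  exact this

/-- The universal property of the Grothendieck group. -/
def lift {G : Type 1} [AddCommGroup G] (f : WMod σ ω t → G)
    (hf : ∀ M' M M'' : WMod σ ω t, K0Rel k M' M M'' → f M = f M' + f M'') : K0 k σ ω t →+ G :=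
  QuotientAddGroup.lift (K0Relations k σ ω t) (FreeAbelianGroup.lift f) (by
    unfold K0Relations
    rw [AddSubgroup.closure_le]
    rintro _ ⟨M', M, M'', h, rfl⟩
    simp [hf M' M M'' h])

theorem lift_cls {G : Type 1} [AddCommGroup G] (f : WMod σ ω t → G)
    (hf : ∀ M' M M'' : WMod σ ω t, K0Rel k M' M M'' → f M = f M' + f M'') (M : WMod σ ω t) :
    lift (k := k) f hf (cls k M) = f M :=
  FreeAbelianGroup.lift_apply_of f M

theorem induction {P : K0 k σ ω t → Prop} (h : ∀ M, P (cls k M)) (hneg : ∀ x, P x → P (-x))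
    (hadd : ∀ x y, P x → P y → P (x + y)) (x : K0 k σ ω t) : P x := by
  obtain ⟨x, rfl⟩ := QuotientAddGroup.mk'_surjective (K0Relations k σ ω t) x
  induction x using FreeAbelianGroup.induction_on with
  | zero =>
    have := hadd _ _ (h (WMod.zero σ ω t)) (hneg _ (h (WMod.zero σ ω t)))
    rw [add_neg_cancel] at this
    exact this
  | of M => exact h M
  | neg M hM => exact hneg _ hM
  | add x y hx hy => exact hadd _ _ hx hy

theorem cls_eq {M N : WMod σ ω t} (e : M ≃ₗ[GWA σ t] N) : cls k M = cls k N := by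
  have h0 := cls_rel (K0Rel.ofEquiv k (LinearEquiv.refl (GWA σ t) (WMod.zero σ ω t)))
  rw [cls_rel (K0Rel.ofEquiv k e), left_eq_add.mp h0, add_zero]

/-- The multiplication `[M] [N] = [M ⊗_R N]`. -/
def mul : K0 k σ ω t →ₗ[ℤ] K0 k σ ω t' →ₗ[ℤ] K0 k σ ω (t * t') :=
  (lift (fun M => (lift (fun N => cls k (M.tensor N))
      (fun _ _ _ h => cls_rel (h.tensor_left M))).toIntLinearMap)
    (fun M' M M'' h => by
      ext x
      induction x using K0.induction with
      | h N => simpa [lift_cls] using cls_rel (h.tensor_right N)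
      | hneg x hx => rw [map_neg, map_neg, hx]
      | hadd x y hx hy => rw [map_add, map_add, hx, hy])).toIntLinearMap

theorem mul_cls (M : WMod σ ω t) (N : WMod σ ω t') :
    mul (cls k M) (cls k N) = cls k (M.tensor N) := by
  simp [mul, lift_cls]

/-- The canonical map from the split Grothendieck group to the Grothendieck group. -/
def proj (σ : R ≃+* R) (ω : Set (MaximalSpectrum R)) (t : R) :
    K0 .split σ ω t →ₗ[ℤ] K0 .all σ ω t :=
  (lift (cls .all) fun _ _ _ h => cls_rel (h.ofSplit .all)).toIntLinearMap

theorem proj_cls (M : WMod σ ω t) : proj σ ω t (cls .split M) = cls .all M := by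
  simp [proj, lift_cls]

end K0

end groth

section ring
variable {R : Type} [CommRing R]

section coherence
variable {σ : R ≃+* R} {ω : Set (MaximalSpectrum R)} {t t' t'' : R}

theorem assoc_X (M : WMod σ ω t) (N : WMod σ ω t') (P : WMod σ ω t'') (v : (M ⊗[R] N) ⊗[R] P) :
    TensorProduct.assoc R M N P (((M.tensor N).tensor P).actX v) =
      (M.tensor (N.tensor P)).actX (TensorProduct.assoc R M N P v) := by
  have h : ∀ v : (M ⊗[R] N) ⊗[R] P,
      TensorProduct.assoc R M N P (TensorProduct.map (TensorProduct.map M.actX N.actX) P.actX v) =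
      TensorProduct.map M.actX (TensorProduct.map N.actX P.actX)
        (TensorProduct.assoc R M N P v) := fun v => by
    induction v with
    | zero => simp
    | add a b ha hb => simp only [map_add, ha, hb]
    | tmul a p =>
      induction a with
      | zero => simp
      | add a b ha hb => simp only [map_add, TensorProduct.add_tmul, ha, hb]
      | tmul a b => simp
  have h1 : ((M.tensor N).tensor P).actX v =
      TensorProduct.map (TensorProduct.map M.actX N.actX) P.actX v :=
    (WMod.tensor_X (M.tensor N) P v).trans
      (congrArg (fun f : M ⊗[R] N →ₛₗ[(σ : R →+* R)] M ⊗[R] N => TensorProduct.map f P.actX v)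
        (LinearMap.ext (WMod.tensor_X M N)))
  have h2 : ∀ w : M ⊗[R] (N ⊗[R] P), (M.tensor (N.tensor P)).actX w =
      TensorProduct.map M.actX (TensorProduct.map N.actX P.actX) w := fun w =>
    (WMod.tensor_X M (N.tensor P) w).trans
      (congrArg (fun f : N ⊗[R] P →ₛₗ[(σ : R →+* R)] N ⊗[R] P => TensorProduct.map M.actX f w)
        (LinearMap.ext (WMod.tensor_X N P)))
  exact (congrArg _ h1).trans ((h v).trans (h2 _).symm)

theorem comm_X (M : WMod σ ω t) (N : WMod σ ω t') (v : M ⊗[R] N) :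
    TensorProduct.comm R M N ((M.tensor N).actX v) =
      (N.tensor M).actX (TensorProduct.comm R M N v) := by
  have h : TensorProduct.comm R M N (TensorProduct.map M.actX N.actX v) =
      TensorProduct.map N.actX M.actX (TensorProduct.comm R M N v) := by
    induction v with
    | zero => simp
    | add a b ha hb => simp only [map_add, ha, hb]
    | tmul a b => simp
  exact (congrArg _ (WMod.tensor_X M N v)).trans (h.trans (WMod.tensor_X N M _).symm)

theorem assoc_Y (M : WMod σ ω t) (N : WMod σ ω t') (P : WMod σ ω t'') (v : (M ⊗[R] N) ⊗[R] P) :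
    TensorProduct.assoc R M N P (((M.tensor N).tensor P).actY v) =
      (M.tensor (N.tensor P)).actY (TensorProduct.assoc R M N P v) := by
  have h : ∀ v : (M ⊗[R] N) ⊗[R] P,
      TensorProduct.assoc R M N P (TensorProduct.map (TensorProduct.map M.actY N.actY) P.actY v) =
      TensorProduct.map M.actY (TensorProduct.map N.actY P.actY)
        (TensorProduct.assoc R M N P v) := fun v => by
    induction v with
    | zero => simp
    | add a b ha hb => simp only [map_add, ha, hb]
    | tmul a p =>
      induction a with
      | zero => simp
      | add a b ha hb => simp only [map_add, TensorProduct.add_tmul, ha, hb]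
      | tmul a b => simp
  have h1 : ((M.tensor N).tensor P).actY v =
      TensorProduct.map (TensorProduct.map M.actY N.actY) P.actY v :=
    (WMod.tensor_Y (M.tensor N) P v).trans
      (congrArg (fun f : M ⊗[R] N →ₛₗ[(σ.symm : R →+* R)] M ⊗[R] N => TensorProduct.map f P.actY v)
        (LinearMap.ext (WMod.tensor_Y M N)))
  have h2 : ∀ w : M ⊗[R] (N ⊗[R] P), (M.tensor (N.tensor P)).actY w =
      TensorProduct.map M.actY (TensorProduct.map N.actY P.actY) w := fun w =>
    (WMod.tensor_Y M (N.tensor P) w).trans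
      (congrArg (fun f : N ⊗[R] P →ₛₗ[(σ.symm : R →+* R)] N ⊗[R] P => TensorProduct.map M.actY f w)
        (LinearMap.ext (WMod.tensor_Y N P)))
  exact (congrArg _ h1).trans ((h v).trans (h2 _).symm)

theorem comm_Y (M : WMod σ ω t) (N : WMod σ ω t') (v : M ⊗[R] N) :
    TensorProduct.comm R M N ((M.tensor N).actY v) =
      (N.tensor M).actY (TensorProduct.comm R M N v) := by
  have h : TensorProduct.comm R M N (TensorProduct.map M.actY N.actY v) =
      TensorProduct.map N.actY M.actY (TensorProduct.comm R M N v) := by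
    induction v with
    | zero => simp
    | add a b ha hb => simp only [map_add, ha, hb]
    | tmul a b => simp
  exact (congrArg _ (WMod.tensor_Y M N v)).trans (h.trans (WMod.tensor_Y N M _).symm)

variable [IsFiniteOrbit σ ω]

theorem unit_X (M : WMod σ ω t) (v : ((WMod.unit σ ω).tensor M)) :
    WMod.unitTensor M (((WMod.unit σ ω).tensor M).actX v) =
      M.actX (WMod.unitTensor M v) := by
  let f : (R ⧸ ⨅ m ∈ ω, m.asIdeal) ⊗[R] M →ₗ[R] M := (WMod.unitTensor M).toLinearMap
  have hf : ∀ (a : R) (x : M), f (Ideal.Quotient.mk _ a ⊗ₜ[R] x) = a • x :=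
    WMod.unitTensor_tmul M
  let u : (R ⧸ ⨅ m ∈ ω, m.asIdeal) →ₛₗ[(σ : R →+* R)] (R ⧸ ⨅ m ∈ ω, m.asIdeal) :=
    (WMod.unit σ ω).actX
  have hu : ∀ a : R, u (Ideal.Quotient.mk _ a) = Ideal.Quotient.mk _ (σ a) :=
    WMod.unit_X σ ω
  have h : ∀ v : (R ⧸ ⨅ m ∈ ω, m.asIdeal) ⊗[R] M,
      f (TensorProduct.map u M.actX v) = M.actX (f v) := fun v => by
    induction v with
    | zero => simp
    | add a b ha hb => simp only [map_add, ha, hb]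
    | tmul a x =>
      obtain ⟨a, rfl⟩ := Ideal.Quotient.mk_surjective a
      rw [TensorProduct.map_tmul, hu, hf, hf, LinearMap.map_smulₛₗ]
      rfl
  exact (congrArg f (WMod.tensor_X (WMod.unit σ ω) M v)).trans (h v)

theorem unit_Y (M : WMod σ ω t) (v : ((WMod.unit σ ω).tensor M)) :
    WMod.unitTensor M (((WMod.unit σ ω).tensor M).actY v) =
      M.actY (WMod.unitTensor M v) := by
  let f : (R ⧸ ⨅ m ∈ ω, m.asIdeal) ⊗[R] M →ₗ[R] M := (WMod.unitTensor M).toLinearMap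
  have hf : ∀ (a : R) (x : M), f (Ideal.Quotient.mk _ a ⊗ₜ[R] x) = a • x :=
    WMod.unitTensor_tmul M
  let u : (R ⧸ ⨅ m ∈ ω, m.asIdeal) →ₛₗ[(σ.symm : R →+* R)] (R ⧸ ⨅ m ∈ ω, m.asIdeal) :=
    (WMod.unit σ ω).actY
  have hu : ∀ a : R, u (Ideal.Quotient.mk _ a) = Ideal.Quotient.mk _ (σ.symm a) :=
    WMod.unit_Y σ ω
  have h : ∀ v : (R ⧸ ⨅ m ∈ ω, m.asIdeal) ⊗[R] M,
      f (TensorProduct.map u M.actY v) = M.actY (f v) := fun v => by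
    induction v with
    | zero => simp
    | add a b ha hb => simp only [map_add, ha, hb]
    | tmul a x =>
      obtain ⟨a, rfl⟩ := Ideal.Quotient.mk_surjective a
      rw [TensorProduct.map_tmul, hu, hf, hf, LinearMap.map_smulₛₗ]
      rfl
  exact (congrArg f (WMod.tensor_Y (WMod.unit σ ω) M v)).trans (h v)

end coherence

/-- The complexified (split) Grothendieck group `ℂ ⊗_ℤ K₀(A(t)-wmod_ω)` for the element `t` of a
submonoid `S` of `R`. Mathlib's graded rings have additive index monoids, hence `Additive S`. -/
abbrev Piece (k : K0Kind) (σ : R ≃+* R) (ω : Set (MaximalSpectrum R)) (S : Submonoid R)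
    (i : Additive S) : Type 1 :=
  ℂ ⊗[ℤ] K0 k σ ω (i.toMul : R)

namespace Piece

variable {k : K0Kind} {σ : R ≃+* R} {ω : Set (MaximalSpectrum R)} {S : Submonoid R}

/-- The multiplication `(c [M]) (d [N]) = c d [M ⊗_R N]`. -/
def mul {i j : Additive S} : Piece k σ ω S i →ₗ[ℤ] Piece k σ ω S j →ₗ[ℤ] Piece k σ ω S (i + j) :=
  TensorProduct.map₂ (LinearMap.mul ℤ ℂ) (K0.mul (t := (i.toMul : R)) (t' := (j.toMul : R)))

theorem mul_tmul_cls {i j : Additive S} (c d : ℂ) (M : WMod σ ω (i.toMul : R))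
    (N : WMod σ ω (j.toMul : R)) :
    mul (i := i) (j := j) (c ⊗ₜ[ℤ] K0.cls k M) (d ⊗ₜ[ℤ] K0.cls k N) =
      (c * d) ⊗ₜ[ℤ] K0.cls k (M.tensor N) := by
  change (c * d) ⊗ₜ[ℤ] (K0.mul (K0.cls k M) (K0.cls k N)) = _
  rw [K0.mul_cls]

theorem induction {i : Additive S} {P : Piece k σ ω S i → Prop}
    (h : ∀ (c : ℂ) (M : WMod σ ω (i.toMul : R)), P (c ⊗ₜ[ℤ] K0.cls k M))
    (hadd : ∀ x y, P x → P y → P (x + y)) (x : Piece k σ ω S i) : P x := by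
  induction x using TensorProduct.induction_on with
  | zero => simpa using h 0 (WMod.zero σ ω _)
  | add x y hx hy => exact hadd x y hx hy
  | tmul c x =>
    induction x using K0.induction generalizing c with
    | h M => exact h c M
    | hneg x hx =>
      rw [TensorProduct.tmul_neg, ← TensorProduct.neg_tmul]
      exact hx (-c)
    | hadd x y hx hy => rw [TensorProduct.tmul_add]; exact hadd _ _ (hx c) (hy c)

theorem mk_add {i j : Additive S} {a a' : Piece k σ ω S i} {b b' : Piece k σ ω S j}
    (h : GradedMonoid.mk (A := Piece k σ ω S) i a = GradedMonoid.mk j b)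
    (h' : GradedMonoid.mk (A := Piece k σ ω S) i a' = GradedMonoid.mk j b') :
    GradedMonoid.mk (A := Piece k σ ω S) i (a + a') = GradedMonoid.mk j (b + b') := by
  obtain rfl : i = j := congrArg Sigma.fst h
  obtain rfl := eq_of_heq (Sigma.mk.inj h).2
  obtain rfl := eq_of_heq (Sigma.mk.inj h').2
  rfl

theorem mk_cls {i j : Additive S} (hij : i = j) {c d : ℂ} (hcd : c = d)
    (M : WMod σ ω (i.toMul : R)) (N : WMod σ ω (j.toMul : R))
    (e : M ≃ₗ[R] N) (hX : ∀ v, e (M.actX v) = N.actX (e v))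
    (hY : ∀ v, e (M.actY v) = N.actY (e v)) :
    GradedMonoid.mk (A := Piece k σ ω S) i (c ⊗ₜ[ℤ] K0.cls k M) =
      GradedMonoid.mk j (d ⊗ₜ[ℤ] K0.cls k N) := by
  subst hij hcd
  rw [K0.cls_eq (GWA.linearEquivOf e hX hY)]

section
variable {i j l : Additive S}

theorem mk_assoc (x : Piece k σ ω S i) (y : Piece k σ ω S j) (z : Piece k σ ω S l) :
    GradedMonoid.mk (A := Piece k σ ω S) (i + j + l) (mul (mul x y) z) =
      GradedMonoid.mk (i + (j + l)) (mul x (mul y z)) := by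
  induction x using Piece.induction with
  | hadd x y hx hy => simp only [map_add, LinearMap.add_apply]; exact mk_add hx hy
  | h c M =>
  induction y using Piece.induction with
  | hadd x y hx hy => simp only [map_add, LinearMap.add_apply]; exact mk_add hx hy
  | h d N =>
  induction z using Piece.induction with
  | hadd x y hx hy => simp only [map_add]; exact mk_add hx hy
  | h c' P =>
  have h1 : mul (i := i + j) (j := l) (mul (c ⊗ₜ[ℤ] K0.cls k M) (d ⊗ₜ[ℤ] K0.cls k N))
      (c' ⊗ₜ[ℤ] K0.cls k P) = (c * d * c') ⊗ₜ[ℤ] K0.cls k ((M.tensor N).tensor P) := by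
    rw [mul_tmul_cls]
    exact mul_tmul_cls (i := i + j) (j := l) _ _ (M.tensor N) P
  have h2 : mul (i := i) (j := j + l) (c ⊗ₜ[ℤ] K0.cls k M) (mul (d ⊗ₜ[ℤ] K0.cls k N)
      (c' ⊗ₜ[ℤ] K0.cls k P)) = (c * (d * c')) ⊗ₜ[ℤ] K0.cls k (M.tensor (N.tensor P)) := by
    rw [mul_tmul_cls]
    exact mul_tmul_cls (i := i) (j := j + l) _ _ M (N.tensor P)
  rw [h1, h2]
  let e : ((M.tensor N).tensor P) ≃ₗ[R] (M.tensor (N.tensor P)) := TensorProduct.assoc R M N P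
  refine mk_cls (add_assoc i j l) (mul_assoc c d c') _ _ e
    (assoc_X M N P) (assoc_Y M N P)

theorem mk_comm (x : Piece k σ ω S i) (y : Piece k σ ω S j) :
    GradedMonoid.mk (A := Piece k σ ω S) (i + j) (mul x y) =
      GradedMonoid.mk (j + i) (mul y x) := by
  induction x using Piece.induction with
  | hadd x y hx hy => simp only [map_add, LinearMap.add_apply]; exact mk_add hx hy
  | h c M =>
  induction y using Piece.induction with
  | hadd x y hx hy => simp only [map_add, LinearMap.add_apply]; exact mk_add hx hy
  | h d N =>
  rw [mul_tmul_cls, mul_tmul_cls]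
  let e : (M.tensor N) ≃ₗ[R] (N.tensor M) := TensorProduct.comm R M N
  refine mk_cls (add_comm i j) (mul_comm c d) _ _ e
    (comm_X M N) (comm_Y M N)

/-- The canonical map from the split to the ordinary Grothendieck group, complexified. -/
def proj (σ : R ≃+* R) (ω : Set (MaximalSpectrum R)) (S : Submonoid R) (i : Additive S) :
    Piece .split σ ω S i →ₗ[ℂ] Piece .all σ ω S i :=
  LinearMap.baseChange ℂ (K0.proj σ ω (i.toMul : R))

theorem proj_tmul_cls (c : ℂ) (M : WMod σ ω (i.toMul : R)) :
    proj σ ω S i (c ⊗ₜ[ℤ] K0.cls .split M) = c ⊗ₜ[ℤ] K0.cls .all M := by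
  rw [proj, LinearMap.baseChange_tmul, K0.proj_cls]

theorem proj_mul (x : Piece .split σ ω S i) (y : Piece .split σ ω S j) :
    proj σ ω S (i + j) (mul x y) = mul (proj σ ω S i x) (proj σ ω S j y) := by
  induction x using Piece.induction with
  | hadd x x' hx hx' => simp only [map_add, LinearMap.add_apply, hx, hx']
  | h c M =>
  induction y using Piece.induction with
  | hadd y y' hy hy' => simp only [map_add, hy, hy']
  | h d N =>
  rw [mul_tmul_cls, proj_tmul_cls (i := i), proj_tmul_cls (i := j), mul_tmul_cls]
  exact proj_tmul_cls (i := i + j) _ (M.tensor N)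

variable [IsFiniteOrbit σ ω]

/-- The unit element. -/
def one : Piece k σ ω S 0 := (1 : ℂ) ⊗ₜ[ℤ] K0.cls k (WMod.unit σ ω)

theorem mk_smul_one_mul (c : ℂ) (x : Piece k σ ω S i) :
    GradedMonoid.mk (A := Piece k σ ω S) (0 + i) (mul (c • one) x) = GradedMonoid.mk i (c • x) := by
  induction x using Piece.induction with
  | hadd x y hx hy => simp only [map_add, smul_add]; exact mk_add hx hy
  | h d M =>
  rw [one, TensorProduct.smul_tmul', TensorProduct.smul_tmul']
  erw [mul_tmul_cls]
  refine mk_cls (zero_add i) (by simp) _ _ (WMod.unitTensor M)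
    (unit_X M) (unit_Y M)

theorem mk_one_mul (x : Piece k σ ω S i) :
    GradedMonoid.mk (A := Piece k σ ω S) (0 + i) (mul one x) = GradedMonoid.mk i x := by
  simpa using mk_smul_one_mul 1 x

instance : GradedMonoid.GMonoid (Piece k σ ω S) :=
  letI : GradedMonoid.GOne (Piece k σ ω S) := ⟨one⟩
  letI : GradedMonoid.GMul (Piece k σ ω S) := ⟨fun x y => mul x y⟩
  { one_mul := fun ⟨_, x⟩ => mk_one_mul x
    mul_one := fun ⟨_, x⟩ => (mk_comm x one).trans (mk_one_mul x)
    mul_assoc := fun ⟨_, x⟩ ⟨_, y⟩ ⟨_, z⟩ => mk_assoc x y z }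

instance : DirectSum.GCommRing (Piece k σ ω S) where
  __ := (inferInstance : GradedMonoid.GMonoid (Piece k σ ω S))
  mul_zero _ := map_zero (mul _)
  zero_mul b := LinearMap.congr_fun (map_zero mul) b
  mul_add _ := map_add (mul _)
  add_mul a b c := LinearMap.congr_fun (map_add mul a b) c
  mul_comm := fun ⟨_, x⟩ ⟨_, y⟩ => mk_comm x y
  natCast n := n • one
  natCast_zero := zero_smul _ _
  natCast_succ n := add_smul n 1 one |>.trans (by rw [one_smul]; rfl)
  intCast n := n • one
  intCast_ofNat n := natCast_zsmul one n
  intCast_negSucc_ofNat n := negSucc_zsmul one n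

instance : DirectSum.GAlgebra ℂ (Piece k σ ω S) where
  toFun := (LinearMap.toSpanSingleton ℂ (Piece k σ ω S 0) one).toAddMonoidHom
  map_one := one_smul ℂ one
  map_mul r s := by
    refine Eq.trans ?_ (mk_smul_one_mul r (s • one : Piece k σ ω S 0)).symm
    rw [smul_smul]
    rfl
  commutes r := fun ⟨_, x⟩ => mk_comm (r • one) x
  smul_def r := fun ⟨_, x⟩ => (mk_smul_one_mul r x).symm

end

end Piece

variable (k : K0Kind) (σ : R ≃+* R) (ω : Set (MaximalSpectrum R)) (S : Submonoid R)

/-- The Grothendieck ring `⨁_{t ∈ S} ℂ ⊗_ℤ K₀(A(t)-wmod_ω)` (`k = .all`) or the split Grothendieck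
ring `⨁_{t ∈ S} ℂ ⊗_ℤ K₀^split(A(t)-wmod_ω)` (`k = .split`). -/
def GrothRing : Type 1 := ⨁ i : Additive S, Piece k σ ω S i

namespace GrothRing

open scoped Classical in
instance [IsFiniteOrbit σ ω] : CommRing (GrothRing k σ ω S) :=
  inferInstanceAs (CommRing (⨁ i : Additive S, Piece k σ ω S i))

open scoped Classical in
instance [IsFiniteOrbit σ ω] : Algebra ℂ (GrothRing k σ ω S) :=
  inferInstanceAs (Algebra ℂ (⨁ i : Additive S, Piece k σ ω S i))

variable {σ ω S}

open scoped Classical in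
/-- The class `[M]` of an object `M` of `A(t)-wmod_ω`, in degree `t`. -/
def cls (t : S) (M : WMod σ ω (t : R)) : GrothRing k σ ω S :=
  DirectSum.of (Piece k σ ω S) (Additive.ofMul t) ((1 : ℂ) ⊗ₜ[ℤ] K0.cls k M)

variable [IsFiniteOrbit σ ω]

/-- The multiplication is given by `[M] [N] = [M ⊗_R N]`. -/
theorem cls_mul_cls (t t' : S) (M : WMod σ ω (t : R)) (N : WMod σ ω (t' : R)) :
    cls k t M * cls k t' N = cls k (t * t') (M.tensor N) := by
  classical
  refine (DirectSum.of_mul_of _ _).trans ?_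
  refine congrArg (DirectSum.of (Piece k σ ω S) (Additive.ofMul (t * t'))) ?_
  refine (Piece.mul_tmul_cls (i := Additive.ofMul t) (j := Additive.ofMul t') 1 1 M N).trans ?_
  rw [one_mul]

open scoped Classical in
/-- The canonical algebra map from the split Grothendieck ring to the Grothendieck ring, with
`[M] ↦ [M]`. -/
def proj (σ : R ≃+* R) (ω : Set (MaximalSpectrum R)) (S : Submonoid R) [IsFiniteOrbit σ ω] :
    GrothRing .split σ ω S →ₐ[ℂ] GrothRing .all σ ω S :=
  DirectSum.toAlgebra ℂ (Piece .split σ ω S)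
    (fun i => (DirectSum.lof ℂ (Additive S) (Piece .all σ ω S) i :
        Piece .all σ ω S i →ₗ[ℂ] GrothRing .all σ ω S) ∘ₗ Piece.proj σ ω S i)
    (congrArg (DirectSum.of (Piece .all σ ω S) 0)
      (Piece.proj_tmul_cls (i := (0 : Additive S)) 1 (WMod.unit σ ω)))
    (fun {i j} x y => (congrArg (DirectSum.of (Piece .all σ ω S) (i + j))
      (Piece.proj_mul x y)).trans (DirectSum.of_mul_of _ _).symm)

theorem proj_cls (t : S) (M : WMod σ ω (t : R)) : proj σ ω S (cls .split t M) = cls .all t M := by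
  classical
  exact (DirectSum.toModule_lof ℂ _ _).trans
    (congrArg (DirectSum.of (Piece .all σ ω S) (Additive.ofMul t))
      (Piece.proj_tmul_cls (i := Additive.ofMul t) 1 M))

end GrothRing
end ring

/-! ### The base ring `ℂ[z, z⁻¹]` with `σ(z) = q⁻¹ z` -/

section base

open LaurentPolynomial

theorem laurent_hom_ext {A : Type} [CommRing A] {f g : ℂ[T;T⁻¹] →+* A}
    (hC : ∀ a, f (C a) = g (C a)) (hT : f (T 1) = g (T 1)) : f = g := by
  refine IsLocalization.ringHom_ext (Submonoid.powers (Polynomial.X : Polynomial ℂ)) ?_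
  refine Polynomial.ringHom_ext (fun a => ?_) ?_
  · simpa using hC a
  · simpa using hT

/-- The unit `c z` of `ℂ[z, z⁻¹]`. -/
def unitCZ (c : ℂˣ) : ℂ[T;T⁻¹]ˣ where
  val := C (c : ℂ) * T 1
  inv := C ((c⁻¹ : ℂˣ) : ℂ) * T (-1)
  val_inv := by
    rw [mul_mul_mul_comm, ← map_mul, ← T_add]; simp
  inv_val := by
    rw [mul_mul_mul_comm, ← map_mul, ← T_add]; simp

/-- The endomorphism `f(z) ↦ f(c z)` of `ℂ[z, z⁻¹]`. -/
def scale (c : ℂˣ) : ℂ[T;T⁻¹] →+* ℂ[T;T⁻¹] := eval₂ C (unitCZ c)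

theorem scale_C (c : ℂˣ) (a : ℂ) : scale c (C a) = C a := eval₂_C ..

theorem scale_T (c : ℂˣ) : scale c (T 1) = C (c : ℂ) * T 1 := by
  rw [scale, eval₂_T, zpow_one, unitCZ]

theorem scale_comp (c d : ℂˣ) (h : c * d = 1) : (scale c).comp (scale d) = RingHom.id _ := by
  refine laurent_hom_ext (fun a => ?_) ?_
  · simp [scale_C]
  · rw [RingHom.comp_apply, scale_T, map_mul, scale_C, scale_T, ← mul_assoc, ← map_mul,
      ← Units.val_mul, mul_comm d, h]
    simp

/-- The primitive `p`-th root of unity `q = exp(2πi/p)`. -/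
def q (p : ℕ) : ℂˣ := Units.mk0 (Complex.exp (2 * Real.pi * Complex.I / p)) (Complex.exp_ne_zero _)

/-- The automorphism `σ` of `ℂ[z, z⁻¹]` with `σ(z) = q⁻¹ z` that is the identity on `ℂ`. -/
def sigma (p : ℕ) : ℂ[T;T⁻¹] ≃+* ℂ[T;T⁻¹] :=
  RingEquiv.ofRingHom (scale (q p)⁻¹) (scale (q p)) (scale_comp _ _ (inv_mul_cancel _))
    (scale_comp _ _ (mul_inv_cancel _))

/-- The orbit `ω = {(z - q ^ k) | 0 ≤ k < p}` of the maximal ideal `(z - 1)`. -/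
def orbit (p : ℕ) : Set (MaximalSpectrum ℂ[T;T⁻¹]) :=
  {m | ∃ k < p, m.asIdeal = Ideal.span {T 1 - C ((q p : ℂ) ^ k)}}

/-- The monoid `M₀` of powers of `z - 1`. -/
def M0 : Submonoid ℂ[T;T⁻¹] := Submonoid.powers (T 1 - 1)

theorem span_isMaximal (a : ℂˣ) : (Ideal.span {T 1 - C (a : ℂ)} : Ideal ℂ[T;T⁻¹]).IsMaximal := by
  let f : ℂ[T;T⁻¹] →+* ℂ := eval₂ (RingHom.id ℂ) a
  have hf : Function.Surjective f := fun x => ⟨C x, eval₂_C ..⟩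
  have : RingHom.ker f = Ideal.span {T 1 - C (a : ℂ)} := by
    apply le_antisymm
    · intro x hx
      have h : Ideal.Quotient.mk (Ideal.span {T 1 - C (a : ℂ)}) =
          ((Ideal.Quotient.mk (Ideal.span {T 1 - C (a : ℂ)})).comp C).comp f := by
        refine laurent_hom_ext (fun b => ?_) ?_
        · simp [f]
        · have h1 : f (T 1) = a := by simp [f, eval₂_T]
          rw [RingHom.comp_apply, RingHom.comp_apply, h1, Ideal.Quotient.eq]
          exact Ideal.mem_span_singleton_self _
      rw [← Ideal.Quotient.eq_zero_iff_mem, h, RingHom.comp_apply, RingHom.mem_ker.mp hx, map_zero]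
    · rw [Ideal.span_singleton_le_iff_mem, RingHom.mem_ker]
      simp [f, eval₂_T]
  rw [← this]
  exact RingHom.ker_isMaximal_of_surjective f hf

theorem map_sigma (p : ℕ) (a : ℂˣ) :
    (Ideal.span {T 1 - C (a : ℂ)}).map (sigma p) = Ideal.span {T 1 - C ((q p * a : ℂˣ) : ℂ)} := by
  rw [Ideal.map_span, Set.image_singleton]
  have h : (sigma p) (T 1 - C (a : ℂ)) =
      (T 1 - C ((q p * a : ℂˣ) : ℂ)) * C (((q p)⁻¹ : ℂˣ) : ℂ) := by
    change scale (q p)⁻¹ _ = _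
    rw [map_sub, scale_T, scale_C, sub_mul, ← map_mul, ← Units.val_mul, mul_comm (q p) a,
      mul_inv_cancel_right, mul_comm]
  rw [h]
  exact Ideal.span_singleton_mul_right_unit (((q p)⁻¹).isUnit.map C) _

theorem map_sigma_zpow (p : ℕ) (n : ℤ) (a : ℂˣ) :
    (Ideal.span {T 1 - C (a : ℂ)}).map (sigma p ^ n : ℂ[T;T⁻¹] ≃+* ℂ[T;T⁻¹]) =
      Ideal.span {T 1 - C ((q p ^ n * a : ℂˣ) : ℂ)} := by
  have hcomp : ∀ (f g : ℂ[T;T⁻¹] ≃+* ℂ[T;T⁻¹]) (I : Ideal ℂ[T;T⁻¹]),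
      I.map (f * g : ℂ[T;T⁻¹] ≃+* ℂ[T;T⁻¹]) = (I.map g).map f := fun f g I =>
    (Ideal.map_map (g : ℂ[T;T⁻¹] →+* ℂ[T;T⁻¹]) (f : ℂ[T;T⁻¹] →+* ℂ[T;T⁻¹])).symm
  have hinv : ∀ a : ℂˣ, (Ideal.span {T 1 - C (a : ℂ)}).map
      ((sigma p)⁻¹ : ℂ[T;T⁻¹] ≃+* ℂ[T;T⁻¹]) =
      Ideal.span {T 1 - C (((q p)⁻¹ * a : ℂˣ) : ℂ)} := fun a => by
    have h := map_sigma p ((q p)⁻¹ * a)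
    rw [mul_inv_cancel_left] at h
    rw [← h, ← hcomp, inv_mul_cancel]
    exact Ideal.map_id _
  induction n using Int.induction_on with
  | zero =>
    rw [zpow_zero, zpow_zero, one_mul]
    exact Ideal.map_id _
  | succ n ih => rw [add_comm, zpow_add, zpow_one, hcomp, ih, map_sigma, zpow_add, zpow_one,
      mul_assoc]
  | pred n ih => rw [sub_eq_neg_add, zpow_add, zpow_neg_one, hcomp, ih, hinv, zpow_add,
      zpow_neg_one, mul_assoc]

theorem q_pow (p : ℕ) [NeZero p] : q p ^ p = 1 := by
  have := (Complex.isPrimitiveRoot_exp p (NeZero.ne p)).pow_eq_one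
  exact Units.ext this

instance isFiniteOrbit (p : ℕ) [NeZero p] : IsFiniteOrbit (sigma p) (orbit p) where
  finite := by
    refine Set.Finite.of_finite_image (f := MaximalSpectrum.asIdeal) ?_
      (fun _ _ _ _ h => MaximalSpectrum.ext h)
    refine ((Set.finite_lt_nat p).image
      fun k => Ideal.span {T 1 - C ((q p : ℂ) ^ k)}).subset ?_
    rintro _ ⟨m, ⟨k, hk, h⟩, rfl⟩
    exact ⟨k, hk, h.symm⟩
  orbit := by
    refine ⟨⟨_, span_isMaximal 1⟩, ⟨0, NeZero.pos p, by simp⟩, ?_⟩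
    ext m
    simp only [Set.mem_ofPred_eq, map_sigma_zpow, mul_one, orbit]
    constructor
    · rintro ⟨k, -, h⟩
      exact ⟨k, by simpa using h⟩
    · rintro ⟨n, h⟩
      have hp : (0 : ℤ) < p := by exact_mod_cast NeZero.pos p
      refine ⟨(n % p).toNat, ?_, ?_⟩
      · have := Int.emod_lt_of_pos n hp
        have := Int.emod_nonneg n hp.ne'
        omega
      · have h1 : q p ^ n = q p ^ (n % p).toNat := by
          rw [← zpow_natCast, Int.toNat_of_nonneg (Int.emod_nonneg n hp.ne')]
          conv_lhs => rw [← Int.emod_add_mul_ediv n p, zpow_add, zpow_mul, zpow_natCast, q_pow,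
            one_zpow, mul_one]
        rw [h, h1, Units.val_pow_eq_pow_val]

end base

/-! ### The rings `𝒜^split(ω, M₀)` and `𝒜(ω, M₀)`, and the subspaces `𝒜_(j)` -/

/-- The split Grothendieck ring `𝒜^split(ω, M₀)`. -/
abbrev ASplit (p : ℕ) : Type 1 := GrothRing .split (sigma p) (orbit p) M0

/-- The Grothendieck ring `𝒜(ω, M₀)`. -/
abbrev AGroth (p : ℕ) : Type 1 := GrothRing .all (sigma p) (orbit p) M0

/-- A nonzero module that is not the direct sum of two nonzero submodules. -/
def IsIndecomposable (A V : Type) [Ring A] [AddCommGroup V] [Module A V] : Prop :=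
  Nontrivial V ∧ ∀ N P : Submodule A V, IsCompl N P → N = ⊥ ∨ P = ⊥

/-- The subspace `𝒜_(j)` of `𝒜^split(ω, M₀)` spanned by the classes of indecomposable weight modules
of length at most `j`. -/
def lengthSpan (p : ℕ) [NeZero p] (j : ℕ) : Submodule ℂ (ASplit p) :=
  Submodule.span ℂ {x | ∃ (t : M0) (M : WMod (sigma p) (orbit p) (t : LaurentPolynomial ℂ)),
    IsIndecomposable (GWA (sigma p) (t : LaurentPolynomial ℂ)) M ∧
    Module.length (GWA (sigma p) (t : LaurentPolynomial ℂ)) M ≤ j ∧ x = GrothRing.cls .split t M}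

end WeightRing

end

open WeightRing

/-
Let `t` vanish at no point of the orbit other than `1`. Over `A(t)` a weight vector can then be
carried by `X` and `Y` to every point of the orbit without being killed, and `X ^ p` and `Y ^ p` are
central, so the simple weight modules are exactly the thin ones: those with one-dimensional weight
spaces at all points of the orbit. Tensor products over `R` preserve thinness. Moreover a simple
module is determined by its central character: if `M` and `N` have the same one, choose nonzero
`v ∈ M` and `w ∈ N` at the point `q`, the first one met on leaving `1` along `X`; then `(v, w)`
generates a thin, hence simple, submodule of `M × N` that maps isomorphically to both factors. By
Dedekind's independence of characters, the traces on pairwise nonisomorphic simple modules are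
linearly independent. Traces factor through `K₀`, so `π` is injective on the span of the classes of
simple modules; it maps this span onto `𝒜(ω, M₀)` by Jordan–Hölder, and `s` is the inverse.
-/

noncomputable section

namespace WeightRing

section Weight

variable {R : Type} [CommRing R] {V W : Type} [AddCommGroup V] [Module R V]
  [AddCommGroup W] [Module R W] {ω : Set (MaximalSpectrum R)} {m : MaximalSpectrum R}

theorem smul_eq_zero_of_mem_weightSpace {v : V} (hv : v ∈ weightSpace R V m) {a : R}
    (ha : a ∈ m.asIdeal) : a • v = 0 :=
  (Submodule.mem_torsionBySet_iff _ _).mp hv ⟨a, ha⟩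

theorem mem_weightSpace_iff {v : V} : v ∈ weightSpace R V m ↔ ∀ a ∈ m.asIdeal, a • v = 0 := by
  simp only [weightSpace, Submodule.mem_torsionBySet_iff, Subtype.forall, SetLike.mem_coe]

theorem map_weightSpace_le (f : V →ₗ[R] W) :
    (weightSpace R V m).map f ≤ weightSpace R W m := by
  rintro _ ⟨v, hv, rfl⟩
  exact mem_weightSpace_iff.mpr fun a ha => by
    rw [← map_smul, smul_eq_zero_of_mem_weightSpace hv ha, map_zero]

theorem weightSpace_prod :
    weightSpace R (V × W) m = (weightSpace R V m).prod (weightSpace R W m) := by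
  ext v
  simp only [Submodule.mem_prod, mem_weightSpace_iff, Prod.ext_iff, Prod.smul_fst, Prod.smul_snd,
    Prod.fst_zero, Prod.snd_zero, forall_and]

theorem IsFinWeightOn.of_surjective (hV : IsFinWeightOn R V ω) (f : V →ₗ[R] W)
    (hf : Function.Surjective f) : IsFinWeightOn R W ω := by
  have hsup : ⨆ m, (weightSpace R V m).map f = ⊤ := by
    rw [← Submodule.map_iSup, isWeight_iff.mp hV.isWeight, Submodule.map_top,
      LinearMap.range_eq_top.mpr hf]
  have heq := weightSpace_eq _ (fun m => map_weightSpace_le (m := m) f) hsup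
  refine ⟨isWeight_iff.mpr ?_, fun m => ?_, fun m hm => hV.supp m fun h => hm ?_⟩
  · simpa only [heq] using hsup
  · have := (finite_quot_iff m).mp (hV.finite m)
    rw [finite_quot_iff, heq m]
    infer_instance
  · rw [heq m, h, Submodule.map_bot]

theorem IsFinWeightOn.of_injective (hV : IsFinWeightOn R V ω) (f : W →ₗ[R] V)
    (hf : Function.Injective f) : IsFinWeightOn R W ω := by
  obtain ⟨g, hg⟩ := hV.isWeight.exists_retraction f hf
  exact hV.of_surjective g fun w => ⟨f w, LinearMap.congr_fun hg w⟩

theorem IsFinWeightOn.prod (hV : IsFinWeightOn R V ω) (hW : IsFinWeightOn R W ω) :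
    IsFinWeightOn R (V × W) ω := by
  refine ⟨isWeight_iff.mpr ?_, fun m => ?_, fun m hm => ?_⟩
  · have hle : ∀ v, v ∈ ⨆ m, weightSpace R (V × W) m := fun ⟨v, w⟩ => by
      have hv : LinearMap.inl R V W v ∈ ⨆ m, (weightSpace R V m).map (LinearMap.inl R V W) := by
        rw [← Submodule.map_iSup, isWeight_iff.mp hV.isWeight]
        exact ⟨v, trivial, rfl⟩
      have hw : LinearMap.inr R V W w ∈ ⨆ m, (weightSpace R W m).map (LinearMap.inr R V W) := by
        rw [← Submodule.map_iSup, isWeight_iff.mp hW.isWeight]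
        exact ⟨w, trivial, rfl⟩
      simpa using add_mem (iSup_mono (fun m => map_weightSpace_le _) hv)
        (iSup_mono (fun m => map_weightSpace_le _) hw)
    exact eq_top_iff.mpr fun v _ => hle v
  · rw [finite_quot_iff, weightSpace_prod, Module.Finite.iff_fg]
    exact (Module.Finite.iff_fg.mp ((finite_quot_iff m).mp (hV.finite m))).prod
      (Module.Finite.iff_fg.mp ((finite_quot_iff m).mp (hW.finite m)))
  · by_contra hmω
    refine hm ?_
    rw [weightSpace_prod, not_not.mp fun h => hmω (hV.supp m h),
      not_not.mp fun h => hmω (hW.supp m h), Submodule.prod_bot]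

theorem IsFinWeightOn.iSup_mem_eq_top (hV : IsFinWeightOn R V ω) :
    ⨆ m ∈ ω, weightSpace R V m = ⊤ := by
  rw [eq_top_iff, ← isWeight_iff.mp hV.isWeight]
  refine iSup_le fun m => ?_
  by_cases h : weightSpace R V m = ⊥
  · rw [h]
    exact bot_le
  · exact le_iSup₂_of_le m (hV.supp m h) le_rfl

theorem IsFinWeightOn.exists_ne_zero (hV : IsFinWeightOn R V ω) [Nontrivial V] :
    ∃ m ∈ ω, ∃ v ∈ weightSpace R V m, v ≠ 0 := by
  by_contra! h
  have hbot : ⨆ m ∈ ω, weightSpace R V m = ⊥ := by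
    simpa only [iSup_eq_bot, Submodule.eq_bot_iff] using h
  exact bot_ne_top (hbot.symm.trans hV.iSup_mem_eq_top)

theorem torsionOf_eq_of_mem_weightSpace {v : V} (hv : v ∈ weightSpace R V m) (hv0 : v ≠ 0) :
    Ideal.torsionOf R V v = m.asIdeal := by
  refine (m.isMaximal.eq_of_le (fun h => hv0 ?_) fun a ha => ?_).symm
  · rwa [Ideal.eq_top_iff_one, Ideal.mem_torsionOf_iff, one_smul] at h
  · rw [Ideal.mem_torsionOf_iff, smul_eq_zero_of_mem_weightSpace hv ha]

theorem exists_quotient_equiv_span_singleton {v : V} (hv : v ∈ weightSpace R V m) (hv0 : v ≠ 0) :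
    ∃ e : (R ⧸ m.asIdeal) ≃ₗ[R] Submodule.span R {v}, (e 1 : V) = v :=
  ⟨(Submodule.quotEquivOfEq _ _ (torsionOf_eq_of_mem_weightSpace hv hv0).symm).trans
    (Ideal.quotTorsionOfEquivSpanSingleton R V v), one_smul R v⟩

theorem isAtom_span_singleton {v : V} (hv : v ∈ weightSpace R V m) (hv0 : v ≠ 0) :
    IsAtom (Submodule.span R {v}) := by
  obtain ⟨e, -⟩ := exists_quotient_equiv_span_singleton hv hv0
  exact isSimpleModule_iff_isAtom.mp
    (isSimpleModule_iff_quot_maximal.mpr ⟨m.asIdeal, m.isMaximal, ⟨e.symm⟩⟩)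

theorem IsWeight.exists_linearMap_apply_eq_one (hV : IsWeight R V) {v : V}
    (hv : v ∈ weightSpace R V m) (hv0 : v ≠ 0) : ∃ g : V →ₗ[R] R ⧸ m.asIdeal, g v = 1 := by
  obtain ⟨e, he⟩ := exists_quotient_equiv_span_singleton hv hv0
  obtain ⟨g, hg⟩ := hV.exists_retraction _ (Submodule.span R {v}).injective_subtype
  refine ⟨e.symm ∘ₗ g, ?_⟩
  have hgv : g v = e 1 := (congrArg g he).symm.trans (LinearMap.congr_fun hg (e 1))
  rw [LinearMap.comp_apply, hgv, LinearEquiv.coe_coe, e.symm_apply_apply]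

theorem IsWeight.tmul_ne_zero (hV : IsWeight R V) (hW : IsWeight R W) {v : V} {w : W}
    (hv : v ∈ weightSpace R V m) (hw : w ∈ weightSpace R W m) (hv0 : v ≠ 0) (hw0 : w ≠ 0) :
    v ⊗ₜ[R] w ≠ 0 := fun h => by
  obtain ⟨f, hf⟩ := hV.exists_linearMap_apply_eq_one hv hv0
  obtain ⟨g, hg⟩ := hW.exists_linearMap_apply_eq_one hw hw0
  have := m.isMaximal
  have hfg : f v * g w = 0 := by
    simpa using congrArg (TensorProduct.lift ((LinearMap.mul R (R ⧸ m.asIdeal)).compl₁₂ f g)) h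
  rw [hf, hg, one_mul] at hfg
  exact one_ne_zero hfg

/-- `V` is thin on `ω` if its weight spaces with weight in `ω` are simple `R`-modules, that is,
one-dimensional over the residue fields. -/
def IsThin (R V : Type) [CommRing R] [AddCommGroup V] [Module R V]
    (ω : Set (MaximalSpectrum R)) : Prop :=
  ∀ m ∈ ω, IsAtom (weightSpace R V m)

theorem span_singleton_eq_of_isAtom {A U : Type*} [Ring A] [AddCommGroup U] [Module A U]
    {N : Submodule A U} (hN : IsAtom N) {v : U} (hv : v ∈ N) (hv0 : v ≠ 0) :
    Submodule.span A {v} = N :=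
  (hN.le_iff.mp ((Submodule.span_singleton_le_iff_mem v N).mpr hv)).resolve_left
    (mt Submodule.span_singleton_eq_bot.mp hv0)

theorem IsThin.tensor (hV : IsWeight R V) (hW : IsWeight R W) (h : IsThin R V ω)
    (h' : IsThin R W ω) : IsThin R (V ⊗[R] W) ω := by
  intro m hm
  obtain ⟨v, hv, hv0⟩ := (Submodule.ne_bot_iff _).mp (h m hm).1
  obtain ⟨w, hw, hw0⟩ := (Submodule.ne_bot_iff _).mp (h' m hm).1
  have hspan : weightSpace R (V ⊗[R] W) m = Submodule.span R {v ⊗ₜ[R] w} :=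
    calc weightSpace R (V ⊗[R] W) m
        = tensorWeight R V W m := weightSpace_eq _ tensorWeight_le (iSup_tensorWeight hV hW) m
      _ = Submodule.map₂ (TensorProduct.mk R V W) (weightSpace R V m) (weightSpace R W m) :=
        TensorProduct.range_mapIncl _ _
      _ = Submodule.span R {v ⊗ₜ[R] w} := by
        rw [← span_singleton_eq_of_isAtom (h m hm) hv hv0,
          ← span_singleton_eq_of_isAtom (h' m hm) hw hw0, Submodule.map₂_span_span,
          Set.image2_singleton, TensorProduct.mk_apply]
  have hvw : v ⊗ₜ[R] w ∈ weightSpace R (V ⊗[R] W) m :=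
    hspan ▸ Submodule.mem_span_singleton_self _
  rw [hspan]
  exact isAtom_span_singleton hvw (hV.tmul_ne_zero hW hv hw hv0 hw0)

theorem exists_sub_one_mem_and_forall_mem (hω : ω.Finite) (hm : m ∈ ω) :
    ∃ e : R, e - 1 ∈ m.asIdeal ∧ ∀ m' ∈ ω, m' ≠ m → e ∈ m'.asIdeal := by
  classical
  have := hω.to_subtype
  have hcop : Pairwise fun m₁ m₂ : ω => IsCoprime m₁.1.asIdeal m₂.1.asIdeal := fun m₁ m₂ h => by
    have := m₁.1.isMaximal
    have := m₂.1.isMaximal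
    exact Ideal.isCoprime_of_isMaximal fun h' => h (Subtype.ext (MaximalSpectrum.ext h'))
  obtain ⟨e, he⟩ := Ideal.exists_forall_sub_mem_ideal hcop (Pi.single ⟨m, hm⟩ 1)
  refine ⟨e, by simpa using he ⟨m, hm⟩, fun m' hm' hne => ?_⟩
  simpa [hne] using he ⟨m', hm'⟩

theorem IsThin.quot (hω : ω.Finite) : IsThin R (R ⧸ ⨅ m ∈ ω, m.asIdeal) ω := by
  intro m hm
  obtain ⟨e, he, he'⟩ := exists_sub_one_mem_and_forall_mem hω hm
  have hmul : ∀ a ∈ m.asIdeal, ∀ b, (∀ m' ∈ ω, m' ≠ m → b ∈ m'.asIdeal) →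
      a * b ∈ ⨅ m ∈ ω, m.asIdeal := fun a ha b hb => by
    refine (Submodule.mem_iInf _).mpr fun m' => (Submodule.mem_iInf _).mpr fun hm' => ?_
    by_cases h : m' = m
    · exact h ▸ Ideal.mul_mem_right _ _ ha
    · exact Ideal.mul_mem_left _ _ (hb m' hm' h)
  have hmem : Ideal.Quotient.mk _ e ∈ weightSpace R (R ⧸ ⨅ m ∈ ω, m.asIdeal) m :=
    mem_weightSpace_iff.mpr fun a ha => Ideal.Quotient.eq_zero_iff_mem.mpr (hmul a ha e he')
  have hne : Ideal.Quotient.mk (⨅ m ∈ ω, m.asIdeal) e ≠ 0 := fun h => by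
    have hem : e ∈ m.asIdeal := (iInf₂_le m hm : _ ≤ m.asIdeal)
      (Ideal.Quotient.eq_zero_iff_mem.mp h)
    exact m.isMaximal.ne_top ((Ideal.eq_top_iff_one _).mpr (by simpa using sub_mem hem he))
  have hspan : Submodule.span R {Ideal.Quotient.mk (⨅ m ∈ ω, m.asIdeal) e} = weightSpace R _ m := by
    refine le_antisymm ((Submodule.span_singleton_le_iff_mem _ _).mpr hmem) fun x hx => ?_
    obtain ⟨b, rfl⟩ := Ideal.Quotient.mk_surjective x
    have hb : Ideal.Quotient.mk (⨅ m ∈ ω, m.asIdeal) ((e - 1) * b) = 0 :=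
      smul_eq_zero_of_mem_weightSpace hx he
    refine Submodule.mem_span_singleton.mpr ⟨b, ?_⟩
    rw [sub_mul, one_mul, map_sub, sub_eq_zero, mul_comm] at hb
    exact hb
  rw [← hspan]
  exact isAtom_span_singleton hmem hne

end Weight

namespace GWA

variable {R : Type} [CommRing R] {σ : R ≃+* R} {t : R}

theorem commute_of_generators {a : GWA σ t} (hR : ∀ r, Commute a (incl σ t r))
    (hX : Commute a (X σ t)) (hY : Commute a (Y σ t)) (b : GWA σ t) : Commute a b := by
  obtain ⟨b, rfl⟩ := mk_surjective σ t b
  induction b using FreeAlgebra.induction with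
  | grade0 n => simp
  | grade1 x =>
    cases x with
    | coe r => exact hR r
    | X => exact hX
    | Y => exact hY
  | mul b c hb hc => rw [map_mul]; exact hb.mul_right hc
  | add b c hb hc => rw [map_add]; exact hb.add_right hc

theorem X_pow_mul_incl (n : ℕ) (r : R) :
    X σ t ^ n * incl σ t r = incl σ t ((σ ^ n : R ≃+* R) r) * X σ t ^ n := by
  induction n with
  | zero => simp
  | succ n ih =>
    rw [pow_succ', mul_assoc, ih, ← mul_assoc, X_incl, mul_assoc, pow_succ' σ, RingAut.mul_apply]

theorem Y_pow_mul_incl (n : ℕ) (r : R) :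
    Y σ t ^ n * incl σ t ((σ ^ n : R ≃+* R) r) = incl σ t r * Y σ t ^ n := by
  induction n with
  | zero => simp
  | succ n ih =>
    rw [pow_succ, mul_assoc, pow_succ' σ, RingAut.mul_apply, Y_incl, σ.symm_apply_apply,
      ← mul_assoc, ih, mul_assoc]

theorem X_pow_mul_Y_pow (n : ℕ) :
    X σ t ^ n * Y σ t ^ n =
      incl σ t (∏ i ∈ Finset.range n, (σ ^ (i + 1) : R ≃+* R) t) := by
  induction n with
  | zero => simp
  | succ n ih =>
    calc X σ t ^ (n + 1) * Y σ t ^ (n + 1)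
        = X σ t * (X σ t ^ n * Y σ t ^ n) * Y σ t := by
          rw [pow_succ', pow_succ]
          simp only [mul_assoc]
      _ = incl σ t (σ (∏ i ∈ Finset.range n, (σ ^ (i + 1) : R ≃+* R) t) * σ t) := by
          rw [ih, X_incl, mul_assoc, X_Y, ← map_mul]
      _ = incl σ t (∏ i ∈ Finset.range (n + 1), (σ ^ (i + 1) : R ≃+* R) t) := by
          rw [Finset.prod_range_succ', map_prod]
          simp only [← RingAut.mul_apply, ← pow_succ', zero_add, pow_one]

theorem X_pow_mem_center {n : ℕ} (hn : σ ^ n = 1) : X σ t ^ n ∈ Submonoid.center (GWA σ t) := by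
  refine Submonoid.mem_center_iff.mpr fun b =>
    (commute_of_generators (fun r => ?_) ((Commute.refl _).pow_left _) ?_ b).symm
  · rw [Commute, SemiconjBy, X_pow_mul_incl, hn, RingAut.one_apply]
  · obtain _ | n := n
    · simp only [pow_zero, Commute.one_left]
    have hσ : (σ ^ n : R ≃+* R) (σ t) = t := by rw [← RingAut.mul_apply, ← pow_succ, hn]; rfl
    rw [Commute, SemiconjBy, pow_succ, mul_assoc, X_Y, X_pow_mul_incl, hσ, ← pow_succ, pow_succ',
      ← mul_assoc, Y_X]

theorem Y_pow_mem_center {n : ℕ} (hn : σ ^ n = 1) : Y σ t ^ n ∈ Submonoid.center (GWA σ t) := by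
  refine Submonoid.mem_center_iff.mpr fun b =>
    (commute_of_generators (fun r => ?_) ?_ ((Commute.refl _).pow_left _) b).symm
  · have h := Y_pow_mul_incl (σ := σ) (t := t) n r
    rwa [hn, RingAut.one_apply] at h
  · obtain _ | n := n
    · simp only [pow_zero, Commute.one_left]
    have hσ : (σ ^ n : R ≃+* R) (σ t) = t := by rw [← RingAut.mul_apply, ← pow_succ, hn]; rfl
    have h := Y_pow_mul_incl (σ := σ) (t := t) n (σ t)
    rwa [hσ, ← X_Y, ← Y_X, ← mul_assoc, ← pow_succ, mul_assoc, ← pow_succ'] at h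

variable {V : Type} [AddCommGroup V] [Module R V] [Module (GWA σ t) V]
  [IsScalarTower R (GWA σ t) V]

theorem X_smul_smul (r : R) (v : V) : X σ t • r • v = σ r • X σ t • v :=
  (actX σ t).map_smulₛₗ r v

theorem Y_smul_smul (r : R) (v : V) : Y σ t • r • v = σ.symm r • Y σ t • v :=
  (actY σ t).map_smulₛₗ r v

/-- An `R`-submodule that is stable under `X` and `Y`, as an `A(t)`-submodule. -/
def submoduleOf (N : Submodule R V) (hX : ∀ v ∈ N, X σ t • v ∈ N) (hY : ∀ v ∈ N, Y σ t • v ∈ N) :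
    Submodule (GWA σ t) V where
  __ := N.toAddSubmonoid
  smul_mem' a v hv := by
    obtain ⟨a, rfl⟩ := mk_surjective σ t a
    change _ ∈ N
    replace hv : v ∈ N := hv
    induction a using FreeAlgebra.induction generalizing v with
    | grade0 n => simpa [Int.cast_smul_eq_zsmul] using zsmul_mem hv n
    | grade1 x =>
      cases x with
      | coe r =>
        change incl σ t r • v ∈ N
        rw [incl_smul]
        exact N.smul_mem r hv
      | X => exact hX v hv
      | Y => exact hY v hv
    | mul a b ha hb => rw [map_mul, mul_smul]; exact ha _ (hb _ hv)
    | add a b ha hb => rw [map_add, add_smul]; exact add_mem (ha _ hv) (hb _ hv)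

theorem restrictScalars_span_le {s : Set V} (hX : ∀ v ∈ s, X σ t • v ∈ Submodule.span R s)
    (hY : ∀ v ∈ s, Y σ t • v ∈ Submodule.span R s) :
    (Submodule.span (GWA σ t) s).restrictScalars R ≤ Submodule.span R s := by
  have hX' : Submodule.span R s ≤ (Submodule.span R s).comap (actX σ t) := Submodule.span_le.mpr hX
  have hY' : Submodule.span R s ≤ (Submodule.span R s).comap (actY σ t) := Submodule.span_le.mpr hY
  have hle : Submodule.span (GWA σ t) s ≤ submoduleOf (Submodule.span R s) hX' hY' :=
    Submodule.span_le.mpr Submodule.subset_span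
  exact hle

end GWA

theorem isIndecomposable_and_length_le_one_iff {A V : Type} [Ring A] [AddCommGroup V]
    [Module A V] : IsIndecomposable A V ∧ Module.length A V ≤ 1 ↔ IsSimpleModule A V := by
  constructor
  · rintro ⟨⟨_, -⟩, hl⟩
    exact Module.length_eq_one_iff.mp
      (hl.antisymm (Order.one_le_iff_pos.mpr Module.length_pos))
  · intro h
    refine ⟨⟨IsSimpleModule.nontrivial A V, fun N P hNP => ?_⟩, (Module.length_eq_one_iff.mpr h).le⟩
    refine (eq_bot_or_eq_top N).imp_right ?_
    rintro rfl
    exact eq_bot_of_top_isCompl hNP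

section Trace

variable {K : Type*} [Field K]

theorem trace_eq_add_of_exact {V' V V'' : Type*} [AddCommGroup V'] [Module K V']
    [AddCommGroup V] [Module K V] [AddCommGroup V''] [Module K V''] [FiniteDimensional K V']
    [FiniteDimensional K V] [FiniteDimensional K V''] {f : V' →ₗ[K] V} {g : V →ₗ[K] V''}
    (hf : Function.Injective f) (hfg : Function.Exact f g) (hg : Function.Surjective g)
    {a' : Module.End K V'} {a : Module.End K V} {a'' : Module.End K V''}
    (hf' : a ∘ₗ f = f ∘ₗ a') (hg' : g ∘ₗ a = a'' ∘ₗ g) :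
    LinearMap.trace K V a = LinearMap.trace K V' a' + LinearMap.trace K V'' a'' := by
  obtain ⟨s, hs⟩ := g.exists_rightInverse_of_surjective (LinearMap.range_eq_top.mpr hg)
  have hmem : ∀ v, v - s (g v) ∈ LinearMap.range f := fun v => (hfg _).mp <| by
    rw [map_sub, ← LinearMap.comp_apply, hs, LinearMap.id_apply, sub_self]
  let r : V →ₗ[K] V' := (LinearEquiv.ofInjective f hf).symm ∘ₗ
    (LinearMap.id - s ∘ₗ g).codRestrict (LinearMap.range f) hmem
  have hfr : f ∘ₗ r + s ∘ₗ g = LinearMap.id := LinearMap.ext fun v => by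
    have h : f (r v) = v - s (g v) :=
      congrArg Subtype.val ((LinearEquiv.ofInjective f hf).apply_symm_apply ⟨_, hmem v⟩)
    rw [LinearMap.add_apply, LinearMap.comp_apply, h, LinearMap.comp_apply, sub_add_cancel,
      LinearMap.id_apply]
  have hrf : r ∘ₗ f = LinearMap.id := LinearMap.ext fun v => hf <| by
    simpa [hfg.apply_apply_eq_zero] using LinearMap.congr_fun hfr (f v)
  calc LinearMap.trace K V a
      = LinearMap.trace K V (f ∘ₗ (a' ∘ₗ r)) + LinearMap.trace K V ((a ∘ₗ s) ∘ₗ g) := by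
        rw [← map_add, ← LinearMap.comp_assoc, ← hf', LinearMap.comp_assoc, LinearMap.comp_assoc,
          ← LinearMap.comp_add, hfr, LinearMap.comp_id]
    _ = LinearMap.trace K V' a' + LinearMap.trace K V'' a'' := by
        rw [LinearMap.trace_comp_comm', LinearMap.comp_assoc, hrf, LinearMap.comp_id,
          LinearMap.trace_comp_comm', ← LinearMap.comp_assoc, hg', LinearMap.comp_assoc, hs,
          LinearMap.comp_id]

variable {A : Type*} [Ring A] [Algebra K A]

section CentralCharacter

variable (K A) (M : Type*) [AddCommGroup M] [Module K M] [Module A M] [IsScalarTower K A M]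
  [FiniteDimensional K M] [IsSimpleModule A M] [IsAlgClosed K]

theorem exists_smul_eq_smul_of_mem_center {a : A} (ha : a ∈ Submonoid.center A) :
    ∃ c : K, ∀ v : M, a • v = c • v := by
  let f : Module.End A M :=
    { toFun v := a • v
      map_add' := smul_add a
      map_smul' b v := by
        rw [smul_smul, ← Submonoid.mem_center_iff.mp ha b, mul_smul, RingHom.id_apply] }
  obtain ⟨c, hc⟩ := (IsSimpleModule.algebraMap_end_bijective_of_isAlgClosed K).2 f
  exact ⟨c, fun v => (LinearMap.congr_fun hc v).symm⟩

/-- The scalars by which the centre of `A` acts on a finite-dimensional simple module, by Schur's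
lemma. -/
def centralCharacter : Submonoid.center A →* K where
  toFun a := (exists_smul_eq_smul_of_mem_center K A M a.2).choose
  map_one' := by
    have := IsSimpleModule.nontrivial A M
    obtain ⟨v, hv⟩ := exists_ne (0 : M)
    refine smul_left_injective K hv ?_
    dsimp only
    rw [← (exists_smul_eq_smul_of_mem_center K A M (1 : Submonoid.center A).2).choose_spec v,
      Submonoid.coe_one, one_smul, one_smul]
  map_mul' a b := by
    have := IsSimpleModule.nontrivial A M
    obtain ⟨v, hv⟩ := exists_ne (0 : M)
    refine smul_left_injective K hv ?_
    dsimp only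
    rw [← (exists_smul_eq_smul_of_mem_center K A M (a * b).2).choose_spec v, mul_smul,
      ← (exists_smul_eq_smul_of_mem_center K A M b.2).choose_spec v,
      ← (exists_smul_eq_smul_of_mem_center K A M a.2).choose_spec, Submonoid.coe_mul, mul_smul]

variable {A M}

theorem smul_eq_centralCharacter_smul (a : Submonoid.center A) (v : M) :
    (a : A) • v = centralCharacter K A M a • v :=
  (exists_smul_eq_smul_of_mem_center K A M a.2).choose_spec v

end CentralCharacter

theorem linearIndependent_trace [IsAlgClosed K] [CharZero K] {ι : Type*} (M : ι → Type*)
    [∀ i, AddCommGroup (M i)] [∀ i, Module K (M i)] [∀ i, Module A (M i)]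
    [∀ i, IsScalarTower K A (M i)] [∀ i, FiniteDimensional K (M i)] [∀ i, IsSimpleModule A (M i)]
    (h : Function.Injective fun i => centralCharacter K A (M i)) :
    LinearIndependent K fun i (a : A) => LinearMap.trace K (M i) (Algebra.lsmul K K (M i) a) := by
  have hdim : ∀ i, (Module.finrank K (M i) : K) ≠ 0 := fun i => by
    have := IsSimpleModule.nontrivial A (M i)
    exact Nat.cast_ne_zero.mpr Module.finrank_pos.ne'
  have hind : LinearIndependent K fun i (a : Submonoid.center A) =>
      (Module.finrank K (M i) : K) * centralCharacter K A (M i) a :=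
    ((linearIndependent_monoidHom (Submonoid.center A) K).comp _ h).units_smul
      fun i => Units.mk0 _ (hdim i)
  have htrace : ∀ i (a : Submonoid.center A),
      LinearMap.trace K (M i) (Algebra.lsmul K K (M i) (a : A)) =
        Module.finrank K (M i) * centralCharacter K A (M i) a := fun i a => by
    have ha : Algebra.lsmul K K (M i) (a : A) = centralCharacter K A (M i) a • LinearMap.id :=
      LinearMap.ext fun v => smul_eq_centralCharacter_smul K a v
    rw [ha, map_smul, LinearMap.trace_id, smul_eq_mul, mul_comm]
  rw [← funext fun i => funext (htrace i)] at hind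
  exact LinearIndependent.of_comp
    (LinearMap.funLeft K K (Subtype.val : Submonoid.center A → A)) hind

end Trace

section Grothendieck

variable {R : Type} [CommRing R] {σ : R ≃+* R} {ω : Set (MaximalSpectrum R)}

namespace WMod

variable {t : R}

/-- A submodule of a weight module, as a weight module. -/
def ofSubmodule (M : WMod σ ω t) (N : Submodule (GWA σ t) M) : WMod σ ω t where
  carrier := N
  isFinWeightOn := M.isFinWeightOn.of_injective (GWA.restrict σ t N.subtype) N.injective_subtype

/-- The quotient of a weight module by a submodule, as a weight module. -/
def quotient (M : WMod σ ω t) (N : Submodule (GWA σ t) M) : WMod σ ω t where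
  carrier := M ⧸ N
  isFinWeightOn := M.isFinWeightOn.of_surjective (GWA.restrict σ t N.mkQ) N.mkQ_surjective

/-- The direct sum of two weight modules. -/
def prod (M N : WMod σ ω t) : WMod σ ω t where
  carrier := M × N
  isFinWeightOn := M.isFinWeightOn.prod N.isFinWeightOn

theorem k0Rel_quotient (M : WMod σ ω t) (N : Submodule (GWA σ t) M) :
    K0Rel .all (M.ofSubmodule N) M (M.quotient N) :=
  ⟨N.subtype, N.mkQ, N.injective_subtype, LinearMap.exact_subtype_mkQ N, N.mkQ_surjective⟩

theorem k0Rel_of_subsingleton (M : WMod σ ω t) [Subsingleton M] : K0Rel .all M M M :=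
  ⟨0, 0, Function.injective_of_subsingleton _,
    fun x => ⟨fun _ => ⟨x, Subsingleton.elim _ _⟩, fun _ => Subsingleton.elim _ _⟩,
    Function.surjective_to_subsingleton _⟩

end WMod

namespace GrothRing

variable {S : Submonoid R} {k : K0Kind}

theorem cls_eq {t : S} {M N : WMod σ ω (t : R)} (e : M ≃ₗ[GWA σ (t : R)] N) :
    cls k t M = cls k t N := by
  rw [cls, cls, K0.cls_eq e]

/-- The classes of the simple modules, in all degrees. -/
def simpleClasses (k : K0Kind) (σ : R ≃+* R) (ω : Set (MaximalSpectrum R)) (S : Submonoid R) :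
    Set (GrothRing k σ ω S) :=
  {x | ∃ (t : S) (M : WMod σ ω (t : R)), IsSimpleModule (GWA σ (t : R)) M ∧ x = cls k t M}

variable [IsFiniteOrbit σ ω]

theorem cls_rel {t : S} {M' M M'' : WMod σ ω (t : R)} (h : K0Rel k M' M M'') :
    cls k t M = cls k t M' + cls k t M'' := by
  classical
  have htmul : (1 : ℂ) ⊗ₜ[ℤ] K0.cls k M = 1 ⊗ₜ[ℤ] K0.cls k M' + 1 ⊗ₜ[ℤ] K0.cls k M'' := by
    rw [K0.cls_rel h, TensorProduct.tmul_add]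
  exact (congrArg (DirectSum.of (Piece k σ ω S) (Additive.ofMul t)) htmul).trans (map_add _ _ _)

open scoped Classical in
/-- The linear map on the Grothendieck ring with given restrictions to the homogeneous pieces. -/
def lift {V : Type*} [AddCommGroup V] [Module ℂ V] (φ : ∀ i, Piece k σ ω S i →ₗ[ℂ] V) :
    GrothRing k σ ω S →ₗ[ℂ] V :=
  DirectSum.toModule ℂ (Additive S) V φ

theorem lift_cls {V : Type*} [AddCommGroup V] [Module ℂ V] (φ : ∀ i, Piece k σ ω S i →ₗ[ℂ] V)
    (t : S) (M : WMod σ ω (t : R)) :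
    lift φ (cls k t M) = φ (Additive.ofMul t) ((1 : ℂ) ⊗ₜ[ℤ] K0.cls k M) := by
  classical
  exact DirectSum.toModule_lof ℂ (φ := φ) (Additive.ofMul t) _

theorem span_cls_eq_top : Submodule.span ℂ
    {x : GrothRing k σ ω S | ∃ (t : S) (M : WMod σ ω (t : R)), x = cls k t M} = ⊤ := by
  classical
  rw [eq_top_iff]
  rintro x -
  induction x using DirectSum.induction_on with
  | zero => exact zero_mem _
  | add x y hx hy => exact add_mem hx hy
  | of i x =>
    induction x using Piece.induction with
    | hadd x y hx hy => rw [map_add]; exact add_mem hx hy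
    | h c M =>
      have hc : c ⊗ₜ[ℤ] K0.cls k M = c • ((1 : ℂ) ⊗ₜ[ℤ] K0.cls k M) := by
        rw [TensorProduct.smul_tmul', smul_eq_mul, mul_one]
      have hcls : (DirectSum.of (Piece k σ ω S) i (c ⊗ₜ[ℤ] K0.cls k M) : GrothRing k σ ω S) =
          c • cls k i.toMul M := by
        rw [hc]
        exact (DirectSum.lof ℂ (Additive S) (Piece k σ ω S) i).map_smul c _
      rw [hcls]
      exact Submodule.smul_mem _ _ (Submodule.subset_span ⟨_, M, rfl⟩)

theorem span_isIndecomposable_and_length_le_one : Submodule.span ℂ {x : GrothRing k σ ω S |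
      ∃ (t : S) (M : WMod σ ω (t : R)), IsIndecomposable (GWA σ (t : R)) M ∧
        Module.length (GWA σ (t : R)) M ≤ 1 ∧ x = cls k t M} =
    Submodule.span ℂ (simpleClasses k σ ω S) := by
  simp only [simpleClasses, ← isIndecomposable_and_length_le_one_iff, and_assoc]

theorem cls_mem_span_simpleClasses {t : S} {V : Type} [AddCommGroup V] [Module (GWA σ (t : R)) V]
    (hV : IsFiniteLength (GWA σ (t : R)) V) (M : WMod σ ω (t : R)) (e : M ≃ₗ[GWA σ (t : R)] V) :
    cls .all t M ∈ Submodule.span ℂ (simpleClasses .all σ ω S) := by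
  induction hV generalizing M with
  | of_subsingleton =>
    have := e.subsingleton
    rw [left_eq_add.mp (cls_rel M.k0Rel_of_subsingleton)]
    exact zero_mem _
  | @of_simple_quotient V _ _ N _ _ ih =>
    rw [cls_rel (M.k0Rel_quotient (N.comap (e : M →ₗ[GWA σ (t : R)] V)))]
    refine add_mem (ih _ (e.ofSubmodule' N)) (Submodule.subset_span ⟨t, _, ?_, rfl⟩)
    exact IsSimpleModule.congr (Submodule.Quotient.equiv _ N e
      (Submodule.map_comap_eq_of_surjective e.surjective N))

theorem span_simpleClasses_eq_top
    (h : ∀ (t : S) (M : WMod σ ω (t : R)), IsFiniteLength (GWA σ (t : R)) M) :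
    Submodule.span ℂ (simpleClasses .all σ ω S) = ⊤ := by
  rw [eq_top_iff, ← span_cls_eq_top, Submodule.span_le]
  rintro _ ⟨t, M, rfl⟩
  exact cls_mem_span_simpleClasses (h t M) M (.refl _ _)

theorem proj_image_simpleClasses :
    proj σ ω S '' simpleClasses .split σ ω S = simpleClasses .all σ ω S := by
  ext x
  constructor
  · rintro ⟨_, ⟨t, M, hM, rfl⟩, rfl⟩
    exact ⟨t, M, hM, proj_cls t M⟩
  · rintro ⟨t, M, hM, rfl⟩
    exact ⟨_, ⟨t, M, hM, rfl⟩, proj_cls t M⟩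

end GrothRing

end Grothendieck

section LaurentBase

open LaurentPolynomial

/-- Evaluation of Laurent polynomials at `a`. -/
def ev (a : ℂˣ) : ℂ[T;T⁻¹] →+* ℂ := eval₂ (RingHom.id ℂ) a

theorem ev_C (a : ℂˣ) (c : ℂ) : ev a (C c) = c := eval₂_C ..

theorem ev_T (a : ℂˣ) : ev a (T 1) = a := by simp [ev, eval₂_T]

theorem sub_C_ev_mem (a : ℂˣ) (r : ℂ[T;T⁻¹]) :
    r - C (ev a r) ∈ (Ideal.span {T 1 - C (a : ℂ)} : Ideal ℂ[T;T⁻¹]) := by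
  have h : Ideal.Quotient.mk (Ideal.span {T 1 - C (a : ℂ)}) =
      ((Ideal.Quotient.mk (Ideal.span {T 1 - C (a : ℂ)})).comp C).comp (ev a) := by
    refine laurent_hom_ext (fun b => ?_) ?_
    · rw [RingHom.comp_apply, RingHom.comp_apply, ev_C]
    · rw [RingHom.comp_apply, RingHom.comp_apply, ev_T, Ideal.Quotient.eq]
      exact Ideal.mem_span_singleton_self _
  exact Ideal.Quotient.eq.mp (RingHom.congr_fun h r)

theorem mem_span_T_sub_C_iff {a : ℂˣ} {r : ℂ[T;T⁻¹]} :
    r ∈ (Ideal.span {T 1 - C (a : ℂ)} : Ideal ℂ[T;T⁻¹]) ↔ ev a r = 0 := by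
  constructor
  · intro hr
    obtain ⟨s, rfl⟩ := Ideal.mem_span_singleton.mp hr
    rw [map_mul, map_sub, ev_T, ev_C, sub_self, zero_mul]
  · intro hr
    simpa [hr] using sub_C_ev_mem a r

theorem sigma_C (p : ℕ) (c : ℂ) : sigma p (C c) = C c := scale_C ..

theorem sigma_T (p : ℕ) : sigma p (T 1) = C (((q p)⁻¹ : ℂˣ) : ℂ) * T 1 := scale_T ..

theorem ev_sigma (p : ℕ) (a : ℂˣ) (r : ℂ[T;T⁻¹]) : ev (q p * a) (sigma p r) = ev a r := by
  have h : (ev (q p * a)).comp (sigma p : ℂ[T;T⁻¹] →+* ℂ[T;T⁻¹]) = ev a := by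
    refine laurent_hom_ext (fun b => ?_) ?_
    · rw [RingHom.comp_apply, RingHom.coe_coe, sigma_C, ev_C, ev_C]
    · rw [RingHom.comp_apply, RingHom.coe_coe, sigma_T, map_mul, ev_C, ev_T, ev_T,
        ← Units.val_mul, inv_mul_cancel_left]
  exact RingHom.congr_fun h r

theorem ev_sigma_symm (p : ℕ) (a : ℂˣ) (r : ℂ[T;T⁻¹]) :
    ev a ((sigma p).symm r) = ev (q p * a) r := by
  rw [← ev_sigma, (sigma p).apply_symm_apply]

theorem ev_sigma_pow (p n : ℕ) (a : ℂˣ) (r : ℂ[T;T⁻¹]) :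
    ev (q p ^ n * a) ((sigma p ^ n : ℂ[T;T⁻¹] ≃+* ℂ[T;T⁻¹]) r) = ev a r := by
  induction n with
  | zero => rw [pow_zero, pow_zero, one_mul, RingAut.one_apply]
  | succ n ih => rw [pow_succ', pow_succ', RingAut.mul_apply, mul_assoc, ev_sigma, ih]

theorem sigma_pow_C (p n : ℕ) (c : ℂ) : (sigma p ^ n : ℂ[T;T⁻¹] ≃+* ℂ[T;T⁻¹]) (C c) = C c := by
  induction n with
  | zero => rfl
  | succ n ih => rw [pow_succ, RingAut.mul_apply, sigma_C, ih]

theorem sigma_pow_T (p n : ℕ) :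
    (sigma p ^ n : ℂ[T;T⁻¹] ≃+* ℂ[T;T⁻¹]) (T 1) = C (((q p)⁻¹ ^ n : ℂˣ) : ℂ) * T 1 := by
  induction n with
  | zero => simp
  | succ n ih =>
    rw [pow_succ', RingAut.mul_apply, ih, map_mul, sigma_C, sigma_T, ← mul_assoc, ← map_mul,
      ← Units.val_mul, ← pow_succ]

theorem sigma_pow_self (p : ℕ) [NeZero p] : sigma p ^ p = 1 := by
  have h : ((sigma p ^ p : ℂ[T;T⁻¹] ≃+* ℂ[T;T⁻¹]) : ℂ[T;T⁻¹] →+* ℂ[T;T⁻¹]) = RingHom.id _ := by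
    refine laurent_hom_ext (sigma_pow_C p p) ?_
    rw [RingHom.coe_coe, sigma_pow_T, inv_pow, q_pow, inv_one, Units.val_one, map_one, one_mul,
      RingHom.id_apply]
  exact RingEquiv.ext fun r => RingHom.congr_fun h r

theorem q_isPrimitiveRoot (p : ℕ) [NeZero p] : IsPrimitiveRoot (q p) p :=
  IsPrimitiveRoot.coe_units_iff.mp (Complex.isPrimitiveRoot_exp p (NeZero.ne p))

/-- The maximal ideal `(z - q ^ k)`. -/
def wt (p k : ℕ) : MaximalSpectrum ℂ[T;T⁻¹] := ⟨_, span_isMaximal (q p ^ k)⟩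

theorem asIdeal_wt {p k : ℕ} : (wt p k).asIdeal = Ideal.span {T 1 - C ((q p : ℂ) ^ k)} := by
  simp only [wt, Units.val_pow_eq_pow_val]

theorem mem_wt_iff {p k : ℕ} {r : ℂ[T;T⁻¹]} : r ∈ (wt p k).asIdeal ↔ ev (q p ^ k) r = 0 :=
  mem_span_T_sub_C_iff

theorem wt_eq_wt_iff {p k l : ℕ} : wt p k = wt p l ↔ q p ^ k = q p ^ l := by
  constructor
  · intro h
    have hmem : (T 1 - C ((q p ^ k : ℂˣ) : ℂ) : ℂ[T;T⁻¹]) ∈ (wt p l).asIdeal :=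
      h ▸ Ideal.mem_span_singleton_self _
    rw [mem_wt_iff, map_sub, ev_T, ev_C, sub_eq_zero] at hmem
    exact (Units.ext hmem).symm
  · intro h
    simp only [wt, h]

variable {p : ℕ} [NeZero p]

theorem exists_eq_wt {m : MaximalSpectrum ℂ[T;T⁻¹]} (hm : m ∈ orbit p) :
    ∃ k < p, m = wt p (k + 1) := by
  obtain ⟨k, hk, h⟩ := hm
  have h : m = wt p k := MaximalSpectrum.ext (h.trans asIdeal_wt.symm)
  obtain _ | k := k
  · have hp := Nat.sub_add_cancel (NeZero.one_le (n := p))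
    exact ⟨p - 1, by omega, h.trans (wt_eq_wt_iff.mpr (by rw [hp, q_pow, pow_zero]))⟩
  · exact ⟨k, by omega, h⟩

theorem wt_mem_orbit (k : ℕ) : wt p k ∈ orbit p := by
  have h : wt p k = wt p (k % p) := wt_eq_wt_iff.mpr (pow_eq_pow_mod k (q_pow p))
  exact ⟨k % p, Nat.mod_lt _ (NeZero.pos p), h ▸ asIdeal_wt⟩

theorem wt_succ_injOn {k l : ℕ} (hk : k < p) (hl : l < p) (h : wt p (k + 1) = wt p (l + 1)) :
    k = l := by
  rw [wt_eq_wt_iff, pow_succ, pow_succ, mul_left_inj] at h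
  exact (q_isPrimitiveRoot p).pow_inj hk hl h

/-- The Laurent polynomials that vanish at no point of the orbit of `1` other than `1` itself. -/
def nonvanishing (p : ℕ) : Submonoid ℂ[T;T⁻¹] where
  carrier := {t | ∀ k, 0 < k → k < p → ev (q p ^ k) t ≠ 0}
  one_mem' k _ _ := by rw [map_one]; exact one_ne_zero
  mul_mem' ha hb k hk hkp := by rw [map_mul]; exact mul_ne_zero (ha k hk hkp) (hb k hk hkp)

theorem M0_le_nonvanishing (p : ℕ) [NeZero p] : M0 ≤ nonvanishing p := by
  refine Submonoid.powers_le.mpr fun k hk hkp => ?_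
  rw [map_sub, map_one, ev_T]
  exact sub_ne_zero.mpr (mt Units.val_eq_one.mp
    ((q_isPrimitiveRoot p).pow_ne_one_of_pos_of_lt hk.ne' hkp))

end LaurentBase

section WeightModule

open LaurentPolynomial

variable {p : ℕ} {t : ℂ[T;T⁻¹]}

instance : Algebra ℂ (GWA (sigma p) t) :=
  ((GWA.incl (sigma p) t).comp (C : ℂ →+* ℂ[T;T⁻¹])).toAlgebra' fun c a => by
    refine GWA.commute_of_generators (fun r => ?_) ?_ ?_ a
    · exact (Commute.all (C c) r).map (GWA.incl (sigma p) t)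
    · have h := GWA.X_incl (sigma p) t (C c)
      rw [sigma_C] at h
      exact h.symm
    · have h := GWA.Y_incl (sigma p) t (sigma p (C c))
      rw [(sigma p).symm_apply_apply, sigma_C] at h
      exact h.symm

variable (M : WMod (sigma p) (orbit p) t)

instance : Module ℂ M := Module.compHom M (C : ℂ →+* ℂ[T;T⁻¹])

theorem C_smul (c : ℂ) (v : M) : (C c : ℂ[T;T⁻¹]) • v = c • v := rfl

instance : IsScalarTower ℂ ℂ[T;T⁻¹] M where
  smul_assoc c r v := by rw [smul_eq_C_mul, mul_smul, C_smul]

instance : IsScalarTower ℂ (GWA (sigma p) t) M where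
  smul_assoc c a v := by
    rw [Algebra.smul_def, mul_smul]
    exact GWA.incl_smul (sigma p) t (C c) (a • v)

variable {M} {k : ℕ} {v : M}

theorem smul_of_mem_weightSpace (hv : v ∈ weightSpace ℂ[T;T⁻¹] M (wt p k)) (r : ℂ[T;T⁻¹]) :
    r • v = ev (q p ^ k) r • v := by
  rw [← C_smul, ← sub_eq_zero, ← sub_smul]
  exact smul_eq_zero_of_mem_weightSpace hv (sub_C_ev_mem _ r)

theorem X_smul_mem_weightSpace (hv : v ∈ weightSpace ℂ[T;T⁻¹] M (wt p k)) :
    GWA.X (sigma p) t • v ∈ weightSpace ℂ[T;T⁻¹] M (wt p (k + 1)) := by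
  refine mem_weightSpace_iff.mpr fun r hr => ?_
  rw [mem_wt_iff, pow_succ', ← ev_sigma_symm] at hr
  rw [← (sigma p).apply_symm_apply r, ← GWA.X_smul_smul, smul_of_mem_weightSpace hv, hr, zero_smul,
    smul_zero]

theorem Y_smul_mem_weightSpace (hv : v ∈ weightSpace ℂ[T;T⁻¹] M (wt p (k + 1))) :
    GWA.Y (sigma p) t • v ∈ weightSpace ℂ[T;T⁻¹] M (wt p k) := by
  refine mem_weightSpace_iff.mpr fun r hr => ?_
  rw [mem_wt_iff, ← ev_sigma p, ← pow_succ'] at hr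
  rw [← (sigma p).symm_apply_apply r, ← GWA.Y_smul_smul, smul_of_mem_weightSpace hv, hr, zero_smul,
    smul_zero]

theorem X_pow_smul_mem_weightSpace (hv : v ∈ weightSpace ℂ[T;T⁻¹] M (wt p k)) (n : ℕ) :
    GWA.X (sigma p) t ^ n • v ∈ weightSpace ℂ[T;T⁻¹] M (wt p (k + n)) := by
  induction n with
  | zero => rwa [pow_zero, one_smul]
  | succ n ih => rw [pow_succ', mul_smul, ← add_assoc]; exact X_smul_mem_weightSpace ih

theorem X_smul_ne_zero (hk : ev (q p ^ k) t ≠ 0) (hv : v ∈ weightSpace ℂ[T;T⁻¹] M (wt p k))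
    (hv0 : v ≠ 0) : GWA.X (sigma p) t • v ≠ 0 := fun h => by
  have hYX : GWA.Y (sigma p) t • GWA.X (sigma p) t • v = ev (q p ^ k) t • v :=
    (GWA.actY_actX (sigma p) t v).trans (smul_of_mem_weightSpace hv t)
  rw [h, smul_zero] at hYX
  exact smul_ne_zero hk hv0 hYX.symm

theorem Y_smul_ne_zero (hk : ev (q p ^ k) t ≠ 0) (hv : v ∈ weightSpace ℂ[T;T⁻¹] M (wt p (k + 1)))
    (hv0 : v ≠ 0) : GWA.Y (sigma p) t • v ≠ 0 := fun h => by
  have hXY : GWA.X (sigma p) t • GWA.Y (sigma p) t • v = ev (q p ^ k) t • v := by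
    rw [← ev_sigma p, ← pow_succ', ← smul_of_mem_weightSpace hv]
    exact GWA.actX_actY (sigma p) t v
  rw [h, smul_zero] at hXY
  exact smul_ne_zero hk hv0 hXY.symm

variable (M) [NeZero p]

instance : FiniteDimensional ℂ M := by
  have hres : ∀ m : orbit p, Module.Finite ℂ (ℂ[T;T⁻¹] ⧸ m.1.asIdeal) := fun m => by
    obtain ⟨k, -, hk⟩ := exists_eq_wt m.2
    rw [hk]
    refine .of_surjective (Algebra.linearMap ℂ (ℂ[T;T⁻¹] ⧸ (wt p k.succ).asIdeal)) fun x => ?_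
    obtain ⟨r, rfl⟩ := Ideal.Quotient.mk_surjective x
    exact ⟨ev _ r, (Ideal.Quotient.eq.mpr (sub_C_ev_mem _ r)).symm⟩
  have hfin : ∀ m : orbit p, Module.Finite ℂ (weightSpace ℂ[T;T⁻¹] M m.1) := fun m =>
    have := M.isFinWeightOn.finite m.1
    .trans (ℂ[T;T⁻¹] ⧸ m.1.asIdeal) _
  classical
  have := (isFiniteOrbit p).finite.to_subtype
  refine .of_surjective ((DirectSum.coeLinearMap fun m : orbit p =>
    weightSpace ℂ[T;T⁻¹] M m.1).restrictScalars ℂ) (LinearMap.range_eq_top.mp ?_)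
  rw [LinearMap.range_restrictScalars, DirectSum.range_coeLinearMap, iSup_subtype'',
    M.isFinWeightOn.iSup_mem_eq_top, Submodule.restrictScalars_top]

theorem isFiniteLength : IsFiniteLength (GWA (sigma p) t) M :=
  isFiniteLength_iff_isNoetherian_isArtinian.mpr
    ⟨isNoetherian_of_tower ℂ inferInstance, isArtinian_of_tower ℂ inferInstance⟩

variable {M}

theorem exists_mem_weightSpace_ne_zero [Nontrivial M] (ht : t ∈ nonvanishing p) (hk : k < p) :
    ∃ v ∈ weightSpace ℂ[T;T⁻¹] M (wt p (k + 1)), v ≠ 0 := by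
  have hdown : ∀ l < p, (∃ v ∈ weightSpace ℂ[T;T⁻¹] M (wt p (l + 1)), v ≠ 0) →
      ∃ v ∈ weightSpace ℂ[T;T⁻¹] M (wt p 1), v ≠ 0 := fun l hl => by
    induction l with
    | zero => exact id
    | succ l ih =>
      rintro ⟨v, hv, hv0⟩
      exact ih (by omega) ⟨_, Y_smul_mem_weightSpace hv, Y_smul_ne_zero (ht _ (by omega) hl) hv hv0⟩
  obtain ⟨m, hm, hM⟩ := M.isFinWeightOn.exists_ne_zero
  obtain ⟨l, hl, rfl⟩ := exists_eq_wt hm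
  induction k with
  | zero => exact hdown l hl hM
  | succ k ih =>
    obtain ⟨v, hv, hv0⟩ := ih (by omega)
    exact ⟨_, X_smul_mem_weightSpace hv, X_smul_ne_zero (ht _ (by omega) hk) hv hv0⟩

theorem IsThin.isSimpleModule (ht : t ∈ nonvanishing p) (h : IsThin ℂ[T;T⁻¹] M (orbit p)) :
    IsSimpleModule (GWA (sigma p) t) M := by
  have hne : ∀ N : Submodule (GWA (sigma p) t) M, N ≠ ⊥ → N = ⊤ := fun N hN => by
    have : Nontrivial (M.ofSubmodule N) := N.nontrivial_iff_ne_bot.mpr hN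
    have hle : ⨆ m ∈ orbit p, weightSpace ℂ[T;T⁻¹] M m ≤ N.restrictScalars ℂ[T;T⁻¹] := by
      refine iSup₂_le fun m hm => ?_
      obtain ⟨k, hk, rfl⟩ := exists_eq_wt hm
      obtain ⟨u, hu, hu0⟩ := exists_mem_weightSpace_ne_zero (M := M.ofSubmodule N) ht hk
      have huM := map_weightSpace_le (GWA.restrict (sigma p) t N.subtype) ⟨u, hu, rfl⟩
      rw [← span_singleton_eq_of_isAtom (h _ hm) huM (mt (fun h => Subtype.ext h) hu0),
        Submodule.span_singleton_le_iff_mem]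
      exact u.2
    rw [M.isFinWeightOn.iSup_mem_eq_top] at hle
    exact eq_top_iff.mpr hle
  obtain ⟨v, -, hv0⟩ := (Submodule.ne_bot_iff _).mp (h _ (wt_mem_orbit 0)).1
  have : Nontrivial M := ⟨v, 0, hv0⟩
  exact (isSimpleModule_iff _ _).mpr
    { eq_bot_or_eq_top := fun N => or_iff_not_imp_left.mpr (hne N) }

end WeightModule

section Loop

open LaurentPolynomial

variable {p : ℕ} {t : ℂ[T;T⁻¹]} {M : WMod (sigma p) (orbit p) t} {v : M}

theorem X_pow_smul_ne_zero (ht : t ∈ nonvanishing p) (hv : v ∈ weightSpace ℂ[T;T⁻¹] M (wt p 1))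
    (hv0 : v ≠ 0) {k : ℕ} (hk : k < p) : GWA.X (sigma p) t ^ k • v ≠ 0 := by
  induction k with
  | zero => rwa [pow_zero, one_smul]
  | succ k ih =>
    rw [pow_succ', mul_smul]
    exact X_smul_ne_zero (ht (1 + k) (by omega) (by omega)) (X_pow_smul_mem_weightSpace hv k)
      (ih (by omega))

variable [NeZero p]

theorem ev_prod_sigma_pow_ne_zero (ht : t ∈ nonvanishing p) :
    ev 1 (∏ i ∈ Finset.range (p - 1), (sigma p ^ (i + 1) : ℂ[T;T⁻¹] ≃+* ℂ[T;T⁻¹]) t) ≠ 0 := by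
  rw [map_prod, Finset.prod_ne_zero_iff]
  intro i hi
  have hip : i + 1 < p := by rw [Finset.mem_range] at hi; omega
  have hq : q p ^ (i + 1) * q p ^ (p - (i + 1)) = 1 := by
    rw [← pow_add, Nat.add_sub_cancel' hip.le, q_pow]
  rw [← hq, ev_sigma_pow]
  exact ht _ (by omega) (by omega)

theorem Y_smul_mem_span_X_pow_smul (ht : t ∈ nonvanishing p)
    (hv : v ∈ weightSpace ℂ[T;T⁻¹] M (wt p 1)) {y : ℂ} (hy : GWA.Y (sigma p) t ^ p • v = y • v) :
    GWA.Y (sigma p) t • v ∈ Submodule.span ℂ {GWA.X (sigma p) t ^ (p - 1) • v} := by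
  set c := ev 1 (∏ i ∈ Finset.range (p - 1), (sigma p ^ (i + 1) : ℂ[T;T⁻¹] ≃+* ℂ[T;T⁻¹]) t)
  have hc : c ≠ 0 := ev_prod_sigma_pow_ne_zero ht
  have hYv : GWA.Y (sigma p) t • v ∈ weightSpace ℂ[T;T⁻¹] M (wt p 0) := Y_smul_mem_weightSpace hv
  have hXY : c • GWA.Y (sigma p) t • v = y • GWA.X (sigma p) t ^ (p - 1) • v :=
    calc c • GWA.Y (sigma p) t • v
        = (GWA.X (sigma p) t ^ (p - 1) * GWA.Y (sigma p) t ^ (p - 1)) •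
            GWA.Y (sigma p) t • v := by
          rw [GWA.X_pow_mul_Y_pow, GWA.incl_smul, smul_of_mem_weightSpace hYv, pow_zero]
      _ = GWA.X (sigma p) t ^ (p - 1) • GWA.Y (sigma p) t ^ p • v := by
          rw [mul_smul, smul_smul (GWA.Y (sigma p) t ^ (p - 1)), ← pow_succ,
            Nat.sub_add_cancel NeZero.one_le]
      _ = y • GWA.X (sigma p) t ^ (p - 1) • v := by rw [hy, smul_comm]
  exact Submodule.mem_span_singleton.mpr ⟨c⁻¹ * y, by rw [mul_smul, ← hXY, inv_smul_smul₀ hc]⟩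

theorem span_X_pow_smul_eq_top (ht : t ∈ nonvanishing p)
    (hv : v ∈ weightSpace ℂ[T;T⁻¹] M (wt p 1)) (hspan : Submodule.span (GWA (sigma p) t) {v} = ⊤)
    {x y : ℂ} (hx : GWA.X (sigma p) t ^ p • v = x • v) (hy : GWA.Y (sigma p) t ^ p • v = y • v) :
    Submodule.span ℂ[T;T⁻¹] ((fun k => GWA.X (sigma p) t ^ k • v) '' Set.Iio p) = ⊤ := by
  set s := (fun k => GWA.X (sigma p) t ^ k • v) '' Set.Iio p
  have hs : ∀ k < p, GWA.X (sigma p) t ^ k • v ∈ Submodule.span ℂ[T;T⁻¹] s := fun k hk =>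
    Submodule.subset_span ⟨k, hk, rfl⟩
  have hX : ∀ w ∈ s, GWA.X (sigma p) t • w ∈ Submodule.span ℂ[T;T⁻¹] s := by
    rintro _ ⟨k, hk, rfl⟩
    rw [smul_smul, ← pow_succ']
    obtain hlt | heq := (Nat.add_one_le_of_lt hk).lt_or_eq
    · exact hs _ hlt
    · rw [heq, hx, ← C_smul]
      exact Submodule.smul_mem _ _ (by simpa using hs 0 (NeZero.pos p))
  have hY : ∀ w ∈ s, GWA.Y (sigma p) t • w ∈ Submodule.span ℂ[T;T⁻¹] s := by
    rintro _ ⟨_ | k, hk, rfl⟩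
    · obtain ⟨c, hc⟩ := Submodule.mem_span_singleton.mp (Y_smul_mem_span_X_pow_smul ht hv hy)
      simp only [pow_zero, one_smul]
      rw [← hc, ← C_smul]
      exact Submodule.smul_mem _ _ (hs _ (Nat.sub_one_lt (NeZero.ne p)))
    · have hYX : GWA.Y (sigma p) t • GWA.X (sigma p) t ^ (k + 1) • v =
          t • GWA.X (sigma p) t ^ k • v := by
        rw [pow_succ', mul_smul]
        exact GWA.actY_actX (sigma p) t _
      exact hYX ▸ Submodule.smul_mem _ _ (hs k (Nat.lt_of_succ_lt hk))
  have hvs : {v} ⊆ s := Set.singleton_subset_iff.mpr ⟨0, NeZero.pos p, by simp⟩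
  have htop : Submodule.span (GWA (sigma p) t) s = ⊤ :=
    eq_top_iff.mpr (hspan ▸ Submodule.span_mono hvs)
  rw [eq_top_iff, ← Submodule.restrictScalars_top ℂ[T;T⁻¹] (GWA (sigma p) t) M, ← htop]
  exact GWA.restrictScalars_span_le hX hY

theorem isThin_of_span_singleton_eq_top (ht : t ∈ nonvanishing p)
    (hv : v ∈ weightSpace ℂ[T;T⁻¹] M (wt p 1)) (hv0 : v ≠ 0)
    (hspan : Submodule.span (GWA (sigma p) t) {v} = ⊤)
    {x y : ℂ} (hx : GWA.X (sigma p) t ^ p • v = x • v) (hy : GWA.Y (sigma p) t ^ p • v = y • v) :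
    IsThin ℂ[T;T⁻¹] M (orbit p) := by
  have hmem : ∀ k, GWA.X (sigma p) t ^ k • v ∈ weightSpace ℂ[T;T⁻¹] M (wt p (k + 1)) := fun k =>
    add_comm 1 k ▸ X_pow_smul_mem_weightSpace hv k
  let P (m : MaximalSpectrum ℂ[T;T⁻¹]) : Submodule ℂ[T;T⁻¹] M :=
    Submodule.span _ ((fun k => GWA.X (sigma p) t ^ k • v) '' {k | k < p ∧ wt p (k + 1) = m})
  have hP : ∀ m, P m ≤ weightSpace ℂ[T;T⁻¹] M m := fun m => Submodule.span_le.mpr <| by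
    rintro _ ⟨k, ⟨-, rfl⟩, rfl⟩
    exact hmem k
  have hPtop : ⨆ m, P m = ⊤ := by
    rw [eq_top_iff, ← span_X_pow_smul_eq_top ht hv hspan hx hy, Submodule.span_le]
    rintro _ ⟨k, hk, rfl⟩
    exact Submodule.mem_iSup_of_mem (wt p (k + 1)) (Submodule.subset_span ⟨k, ⟨hk, rfl⟩, rfl⟩)
  intro m hm
  obtain ⟨k, hk, rfl⟩ := exists_eq_wt hm
  have hk' : {l | l < p ∧ wt p (l + 1) = wt p (k + 1)} = {k} := Set.ext fun l =>
    ⟨fun h => wt_succ_injOn h.1 hk h.2, by rintro rfl; exact ⟨hk, rfl⟩⟩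
  rw [weightSpace_eq P hP hPtop, show P _ = Submodule.span _ {GWA.X (sigma p) t ^ k • v} by
    rw [← Set.image_singleton (f := fun k => GWA.X (sigma p) t ^ k • v), ← hk']]
  exact isAtom_span_singleton (hmem k) (X_pow_smul_ne_zero ht hv hv0 hk)

end Loop

section Classification

open LaurentPolynomial

variable {p : ℕ} [NeZero p] {t : ℂ[T;T⁻¹]}

theorem isThin_of_isSimpleModule (ht : t ∈ nonvanishing p) (M : WMod (sigma p) (orbit p) t)
    [IsSimpleModule (GWA (sigma p) t) M] : IsThin ℂ[T;T⁻¹] M (orbit p) := by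
  have : Nontrivial M := IsSimpleModule.nontrivial (GWA (sigma p) t) M
  obtain ⟨v, hv, hv0⟩ := exists_mem_weightSpace_ne_zero (M := M) ht (NeZero.pos p)
  exact isThin_of_span_singleton_eq_top ht hv hv0 (IsSimpleModule.span_singleton_eq_top _ hv0)
    (smul_eq_centralCharacter_smul ℂ ⟨_, GWA.X_pow_mem_center (sigma_pow_self p)⟩ v)
    (smul_eq_centralCharacter_smul ℂ ⟨_, GWA.Y_pow_mem_center (sigma_pow_self p)⟩ v)

theorem exists_isSimpleModule_span_pair (ht : t ∈ nonvanishing p)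
    {M N : WMod (sigma p) (orbit p) t} [IsSimpleModule (GWA (sigma p) t) M]
    [IsSimpleModule (GWA (sigma p) t) N]
    (h : centralCharacter ℂ (GWA (sigma p) t) M = centralCharacter ℂ (GWA (sigma p) t) N) :
    ∃ (v : M) (w : N), v ≠ 0 ∧ w ≠ 0 ∧
      IsSimpleModule (GWA (sigma p) t) (Submodule.span (GWA (sigma p) t) {(v, w)}) := by
  have : Nontrivial M := IsSimpleModule.nontrivial (GWA (sigma p) t) M
  have : Nontrivial N := IsSimpleModule.nontrivial (GWA (sigma p) t) N
  obtain ⟨v, hv, hv0⟩ := exists_mem_weightSpace_ne_zero (M := M) ht (NeZero.pos p)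
  obtain ⟨w, hw, hw0⟩ := exists_mem_weightSpace_ne_zero (M := N) ht (NeZero.pos p)
  let D := (M.prod N).ofSubmodule (Submodule.span (GWA (sigma p) t) {(v, w)})
  let u : D := ⟨(v, w), Submodule.mem_span_singleton_self _⟩
  have hu : u ∈ weightSpace ℂ[T;T⁻¹] D (wt p 1) := mem_weightSpace_iff.mpr fun r hr =>
    Subtype.ext (Prod.ext (smul_eq_zero_of_mem_weightSpace hv hr)
      (smul_eq_zero_of_mem_weightSpace hw hr))
  have hcentral : ∀ a : Submonoid.center (GWA (sigma p) t),
      (a : GWA (sigma p) t) • u = centralCharacter ℂ (GWA (sigma p) t) M a • u := fun a =>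
    Subtype.ext (Prod.ext (smul_eq_centralCharacter_smul ℂ a v)
      (h ▸ smul_eq_centralCharacter_smul ℂ a w))
  refine ⟨v, w, hv0, hw0, IsThin.isSimpleModule (M := D) ht ?_⟩
  have hspan : Submodule.span (GWA (sigma p) t) {u} = ⊤ := eq_top_iff.mpr fun x _ => by
    obtain ⟨a, ha⟩ := Submodule.mem_span_singleton.mp (Subtype.property x)
    exact Submodule.mem_span_singleton.mpr ⟨a, Subtype.ext ha⟩
  exact isThin_of_span_singleton_eq_top ht hu
    (fun hu0 => hv0 (congrArg Prod.fst (Subtype.ext_iff.mp hu0))) hspan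
    (hcentral ⟨_, GWA.X_pow_mem_center (sigma_pow_self p)⟩)
    (hcentral ⟨_, GWA.Y_pow_mem_center (sigma_pow_self p)⟩)

theorem nonempty_linearEquiv_of_centralCharacter_eq (ht : t ∈ nonvanishing p)
    {M N : WMod (sigma p) (orbit p) t} [IsSimpleModule (GWA (sigma p) t) M]
    [IsSimpleModule (GWA (sigma p) t) N]
    (h : centralCharacter ℂ (GWA (sigma p) t) M = centralCharacter ℂ (GWA (sigma p) t) N) :
    Nonempty (M ≃ₗ[GWA (sigma p) t] N) := by
  obtain ⟨v, w, hv0, hw0, hD⟩ := exists_isSimpleModule_span_pair ht h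
  set D := Submodule.span (GWA (sigma p) t) {(v, w)}
  let u : D := ⟨(v, w), Submodule.mem_span_singleton_self _⟩
  let f : D →ₗ[GWA (sigma p) t] M := LinearMap.fst _ M N ∘ₗ D.subtype
  let g : D →ₗ[GWA (sigma p) t] N := LinearMap.snd _ M N ∘ₗ D.subtype
  have hf : Function.Bijective f :=
    f.bijective_of_ne_zero fun h0 => hv0 (LinearMap.congr_fun h0 u)
  have hg : Function.Bijective g :=
    g.bijective_of_ne_zero fun h0 => hw0 (LinearMap.congr_fun h0 u)
  exact ⟨(LinearEquiv.ofBijective f hf).symm.trans (LinearEquiv.ofBijective g hg)⟩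

end Classification

section Character

open LaurentPolynomial

variable {p : ℕ} [NeZero p]

namespace K0

variable {t : ℂ[T;T⁻¹]}

/-- The character of a module: the trace of the action of the elements of `A(t)`. -/
def character (t : ℂ[T;T⁻¹]) : K0 .all (sigma p) (orbit p) t →+ (GWA (sigma p) t → ℂ) :=
  QuotientAddGroup.lift (K0Relations .all (sigma p) (orbit p) t)
    (FreeAbelianGroup.lift fun M a => LinearMap.trace ℂ M (Algebra.lsmul ℂ ℂ M a)) (by
      rw [K0Relations, AddSubgroup.closure_le]
      rintro _ ⟨M', M, M'', ⟨f, g, hf, hfg, hg⟩, rfl⟩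
      rw [SetLike.mem_coe, AddMonoidHom.mem_ker, map_sub, map_add, FreeAbelianGroup.lift_apply_of,
        FreeAbelianGroup.lift_apply_of, FreeAbelianGroup.lift_apply_of, sub_eq_zero]
      exact funext fun a =>
        trace_eq_add_of_exact (f := f.restrictScalars ℂ) (g := g.restrictScalars ℂ) hf hfg hg
          (LinearMap.ext fun v => (map_smul f a v).symm) (LinearMap.ext fun v => map_smul g a v))

theorem character_cls (M : WMod (sigma p) (orbit p) t) :
    character t (cls .all M) = fun a => LinearMap.trace ℂ M (Algebra.lsmul ℂ ℂ M a) :=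
  FreeAbelianGroup.lift_apply_of _ M

end K0

/-- The simple weight modules over `A(t)`. -/
abbrev SimpleWMod (p : ℕ) (t : ℂ[T;T⁻¹]) : Type 1 :=
  {M : WMod (sigma p) (orbit p) t // IsSimpleModule (GWA (sigma p) t) M}

namespace SimpleWMod

instance {t : ℂ[T;T⁻¹]} (M : SimpleWMod p t) : IsSimpleModule (GWA (sigma p) t) M.1 := M.2

/-- The central characters of the simple weight modules over `A(t)`. -/
def centralCharacters (p : ℕ) [NeZero p] (t : ℂ[T;T⁻¹]) :
    Set (Submonoid.center (GWA (sigma p) t) →* ℂ) :=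
  Set.range fun M : SimpleWMod p t => centralCharacter ℂ (GWA (sigma p) t) M.1

/-- A simple weight module with a given central character. -/
def ofCentralCharacter {t : ℂ[T;T⁻¹]} (χ : centralCharacters p t) : SimpleWMod p t :=
  Set.rangeSplitting _ χ

theorem centralCharacter_ofCentralCharacter {t : ℂ[T;T⁻¹]} (χ : centralCharacters p t) :
    centralCharacter ℂ (GWA (sigma p) t) (ofCentralCharacter χ).1 = χ :=
  Set.apply_rangeSplitting _ χ

theorem linearIndependent_trace (t : ℂ[T;T⁻¹]) :
    LinearIndependent ℂ fun (χ : centralCharacters p t) (a : GWA (sigma p) t) =>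
      LinearMap.trace ℂ (ofCentralCharacter χ).1 (Algebra.lsmul ℂ ℂ (ofCentralCharacter χ).1 a) :=
  WeightRing.linearIndependent_trace _ fun χ χ' h =>
    Subtype.ext (by simpa only [centralCharacter_ofCentralCharacter] using h)

end SimpleWMod

namespace GrothRing

variable {S : Submonoid ℂ[T;T⁻¹]}

theorem simpleClasses_eq_range (hS : S ≤ nonvanishing p) (k : K0Kind) :
    simpleClasses k (sigma p) (orbit p) S =
      Set.range fun i : Σ t : S, SimpleWMod.centralCharacters p (t : ℂ[T;T⁻¹]) =>
        cls k i.1 (SimpleWMod.ofCentralCharacter i.2).1 := by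
  ext x
  constructor
  · rintro ⟨t, M, hM, rfl⟩
    obtain ⟨e⟩ := nonempty_linearEquiv_of_centralCharacter_eq (hS t.2)
      (SimpleWMod.centralCharacter_ofCentralCharacter ⟨_, ⟨M, hM⟩, rfl⟩)
    exact ⟨⟨t, _⟩, cls_eq e⟩
  · rintro ⟨i, rfl⟩
    exact ⟨i.1, _, (SimpleWMod.ofCentralCharacter i.2).2, rfl⟩

variable (p S) in
open scoped Classical in
/-- The characters of the modules over the algebras `A(t)`, in all degrees `t`. -/
def character : GrothRing .all (sigma p) (orbit p) S →ₗ[ℂ] ∀ t : S, GWA (sigma p) t.1 → ℂ :=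
  lift fun i => LinearMap.single ℂ (fun t : S => GWA (sigma p) t.1 → ℂ) i.toMul ∘ₗ
    (K0.character (i.toMul : ℂ[T;T⁻¹])).toIntLinearMap.liftBaseChange ℂ

open scoped Classical in
theorem character_cls (t : S) (M : WMod (sigma p) (orbit p) (t : ℂ[T;T⁻¹])) :
    character p S (cls .all t M) =
      Pi.single t fun a => LinearMap.trace ℂ M (Algebra.lsmul ℂ ℂ M a) := by
  rw [character, lift_cls, LinearMap.comp_apply, LinearMap.liftBaseChange_tmul, one_smul]
  exact congrArg _ (K0.character_cls M)

variable (p S) in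
theorem linearIndependent_proj_cls : LinearIndependent ℂ
    ((proj (sigma p) (orbit p) S).toLinearMap ∘
      fun i : Σ t : S, SimpleWMod.centralCharacters p (t : ℂ[T;T⁻¹]) =>
        cls .split i.1 (SimpleWMod.ofCentralCharacter i.2).1) := by
  classical
  refine LinearIndependent.of_comp (character p S) ?_
  simp only [Function.comp_def, AlgHom.toLinearMap_apply, proj_cls, character_cls]
  exact Pi.linearIndependent_single
    (fun (t : S) (χ : SimpleWMod.centralCharacters p (t : ℂ[T;T⁻¹])) (a : GWA (sigma p) t.1) =>
      LinearMap.trace ℂ _ (Algebra.lsmul ℂ ℂ (SimpleWMod.ofCentralCharacter χ).1 a))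
    fun t => SimpleWMod.linearIndependent_trace t.1

theorem disjoint_span_simpleClasses_ker_proj (hS : S ≤ nonvanishing p) :
    Disjoint (Submodule.span ℂ (simpleClasses .split (sigma p) (orbit p) S))
      (LinearMap.ker (proj (sigma p) (orbit p) S).toLinearMap) := by
  rw [simpleClasses_eq_range hS]
  exact Submodule.range_ker_disjoint (linearIndependent_proj_cls p S)

end GrothRing

end Character

section Main

open LaurentPolynomial

variable {p : ℕ} [NeZero p]

theorem isSimpleModule_tensor {t t' : ℂ[T;T⁻¹]} (ht : t ∈ nonvanishing p)
    (ht' : t' ∈ nonvanishing p) (M : WMod (sigma p) (orbit p) t) (N : WMod (sigma p) (orbit p) t')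
    [IsSimpleModule (GWA (sigma p) t) M] [IsSimpleModule (GWA (sigma p) t') N] :
    IsSimpleModule (GWA (sigma p) (t * t')) (M.tensor N) :=
  IsThin.isSimpleModule (mul_mem ht ht') ((isThin_of_isSimpleModule ht M).tensor
    M.isFinWeightOn.isWeight N.isFinWeightOn.isWeight (isThin_of_isSimpleModule ht' N))

variable (p) in
theorem isSimpleModule_unit :
    IsSimpleModule (GWA (sigma p) (1 : ℂ[T;T⁻¹])) (WMod.unit (sigma p) (orbit p)) :=
  IsThin.isSimpleModule (one_mem _) (IsThin.quot (isFiniteOrbit p).finite)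

namespace GrothRing

variable {S : Submonoid ℂ[T;T⁻¹]}

/-- The subalgebra spanned by the classes of the simple modules. -/
def simpleSubalgebra (k : K0Kind) (hS : S ≤ nonvanishing p) :
    Subalgebra ℂ (GrothRing k (sigma p) (orbit p) S) :=
  (Submodule.span ℂ (simpleClasses k (sigma p) (orbit p) S)).toSubalgebra
    (Submodule.subset_span ⟨1, WMod.unit _ _, isSimpleModule_unit p, rfl⟩) fun x y hx hy => by
      have hxy := Submodule.mul_mem_mul hx hy
      rw [Submodule.span_mul_span] at hxy
      refine Submodule.span_mono ?_ hxy
      rintro _ ⟨_, ⟨t, M, hM, rfl⟩, _, ⟨t', N, hN, rfl⟩, rfl⟩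
      exact ⟨t * t', M.tensor N, isSimpleModule_tensor (hS t.2) (hS t'.2) M N,
        cls_mul_cls k t t' M N⟩

theorem map_proj_span_simpleClasses :
    (Submodule.span ℂ (simpleClasses .split (sigma p) (orbit p) S)).map
      (proj (sigma p) (orbit p) S).toLinearMap = ⊤ := by
  rw [Submodule.map_span, AlgHom.coe_toLinearMap, proj_image_simpleClasses]
  exact span_simpleClasses_eq_top fun _ M => isFiniteLength M

theorem bijective_proj_comp_val (hS : S ≤ nonvanishing p) :
    Function.Bijective
      ((proj (sigma p) (orbit p) S).comp (simpleSubalgebra .split hS).val) := by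
  refine ⟨(injective_iff_map_eq_zero _).mpr fun b hb => Subtype.ext ?_, fun a => ?_⟩
  · exact Submodule.disjoint_def.mp (disjoint_span_simpleClasses_ker_proj hS) b b.2 hb
  · obtain ⟨b, hb, rfl⟩ := map_proj_span_simpleClasses.ge (Submodule.mem_top (x := a))
    exact ⟨⟨b, hb⟩, rfl⟩

end GrothRing

end Main

end WeightRing

end

theorem theorem5p7_general (p : ℕ) [NeZero p] (S : Submonoid (LaurentPolynomial ℂ))
    (hS : S ≤ nonvanishing p) :
    (∀ (t t' : S) (M : WMod (sigma p) (orbit p) (t : LaurentPolynomial ℂ))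
      (N : WMod (sigma p) (orbit p) (t' : LaurentPolynomial ℂ)),
      IsSimpleModule (GWA (sigma p) (t : LaurentPolynomial ℂ)) M →
      IsSimpleModule (GWA (sigma p) (t' : LaurentPolynomial ℂ)) N →
      IsSimpleModule (GWA (sigma p) ((t : LaurentPolynomial ℂ) * (t' : LaurentPolynomial ℂ)))
        (M.tensor N)) ∧
    Submodule.span ℂ {x | ∃ (t : S) (M : WMod (sigma p) (orbit p) (t : LaurentPolynomial ℂ)),
        IsIndecomposable (GWA (sigma p) (t : LaurentPolynomial ℂ)) M ∧
        Module.length (GWA (sigma p) (t : LaurentPolynomial ℂ)) M ≤ 1 ∧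
          x = GrothRing.cls .split t M} =
      Submodule.span ℂ (GrothRing.simpleClasses .split (sigma p) (orbit p) S) ∧
    Function.Surjective (GrothRing.proj (sigma p) (orbit p) S) ∧
    ∃ B : Subalgebra ℂ (GrothRing .split (sigma p) (orbit p) S), Subalgebra.toSubmodule B =
        Submodule.span ℂ (GrothRing.simpleClasses .split (sigma p) (orbit p) S) ∧
      ∃ s : GrothRing .all (sigma p) (orbit p) S →ₐ[ℂ] GrothRing .split (sigma p) (orbit p) S,
        (GrothRing.proj (sigma p) (orbit p) S).comp s = AlgHom.id ℂ _ ∧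
        ∃ e : GrothRing .all (sigma p) (orbit p) S ≃ₐ[ℂ] B,
          ∀ a, (e a : GrothRing .split (sigma p) (orbit p) S) = s a := by
  have hbij := GrothRing.bijective_proj_comp_val hS
  let e := AlgEquiv.ofBijective _ hbij
  refine ⟨fun t t' M N hM hN => isSimpleModule_tensor (hS t.2) (hS t'.2) M N,
    GrothRing.span_isIndecomposable_and_length_le_one, ?_, GrothRing.simpleSubalgebra .split hS,
    rfl, (GrothRing.simpleSubalgebra .split hS).val.comp e.symm, ?_, e.symm, fun _ => rfl⟩
  · exact Function.Surjective.of_comp hbij.2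
  · exact AlgHom.ext e.apply_symm_apply

theorem theorem5p7 (p : ℕ) [NeZero p] :
    -- the tensor product of two simple weight modules is simple
    (∀ (t t' : M0) (M : WMod (sigma p) (orbit p) (t : LaurentPolynomial ℂ))
      (N : WMod (sigma p) (orbit p) (t' : LaurentPolynomial ℂ)),
      IsSimpleModule (GWA (sigma p) (t : LaurentPolynomial ℂ)) M →
      IsSimpleModule (GWA (sigma p) (t' : LaurentPolynomial ℂ)) N →
      IsSimpleModule (GWA (sigma p) ((t : LaurentPolynomial ℂ) * (t' : LaurentPolynomial ℂ)))
        (M.tensor N)) ∧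
    -- `𝒜_(1)` is the span of the classes of simple weight modules
    lengthSpan p 1 = Submodule.span ℂ
      {x | ∃ (t : M0) (M : WMod (sigma p) (orbit p) (t : LaurentPolynomial ℂ)),
        IsSimpleModule (GWA (sigma p) (t : LaurentPolynomial ℂ)) M ∧
          x = GrothRing.cls .split t M} ∧
    -- the canonical map is surjective
    Function.Surjective (GrothRing.proj (sigma p) (orbit p) M0) ∧
    -- `𝒜_(1)` is a subalgebra, and there is an algebra section of the canonical map that gives an
    -- isomorphism of algebras from `𝒜(ω, M₀)` to `𝒜_(1)`
    ∃ B : Subalgebra ℂ (ASplit p), Subalgebra.toSubmodule B = lengthSpan p 1 ∧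
      ∃ s : AGroth p →ₐ[ℂ] ASplit p,
        (GrothRing.proj (sigma p) (orbit p) M0).comp s = AlgHom.id ℂ (AGroth p) ∧
        ∃ e : AGroth p ≃ₐ[ℂ] B, ∀ a, (e a : ASplit p) = s a := by
  obtain ⟨htensor, hspan, hsurj, B, hB, hs⟩ := theorem5p7_general p M0 (M0_le_nonvanishing p)
  exact ⟨htensor, hspan, hsurj, B, hB.trans hspan.symm, hs⟩
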